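/- Consider a simple polygon $P$, regarded as a closed region in the plane. Two points see each other in $P$ if the segment between them is contained in $P$. A boundary guard is a point on the boundary of $P$, and a set of guards guards a set $T$ if every point of $T$ is seen by at least one of the guards. A nook of $P$ is a chain of three consecutive edges such that the open segment joining the two ends of the chain lies in the interior of $P$. (1) For real numbers $x,y,z$ with $-4<x<4$, the four constraints $$z\ge x,\qquad y\ge z,\qquad \frac{4x+2}{x+4}\ge y,\qquad \frac{4x-2}{-x+4}\ge y$$ hold if and only if $x=y=z=\sqrt2$ or $x=y=z=-\sqrt2$. (2) There is a simple polygon $P$ with integer vertices whose boundary can be guarded by $3$ boundary guards, but by at most $3$ boundary guards only if each of them has an irrational coordinate. More precisely, there are such a polygon $P$, a scaling factor $N\in\mathbb{Z}_{>0}$, intervals $I_x,I_y,I_z\subset(0,\infty)$ with rational end points and with $\sqrt2$ in their interiors, where $I_x\subset(0,4)$, and four pairwise disjoint nooks of $P$, such that, writing $$X(x)=N\,(-x,\,0),\qquad Y(y)=N\left(\tfrac32+\tfrac12y,\;1+y\right),\qquad Z(z)=N\left(\tfrac32+\tfrac12z,\;-1-z\right),$$ the following hold. (a) For all $x\in I_x$,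 $y\in I_y$, $z\in I_z$ the points $X(x),Y(y),Z(z)$ lie on the boundary of $P$. (b) For all $x\in I_x$, $y\in I_y$, $z\in I_z$: the first nook is guarded by $X(x)$ and $Z(z)$ if and only if $z\ge x$; the second is guarded by $Y(y)$ and $Z(z)$ if and only if $y\ge z$; the third is guarded by $X(x)$ and $Y(y)$ if and only if $\frac{4x+2}{x+4}\ge y$; and the fourth is guarded by $X(x)$ and $Y(y)$ if and only if $\frac{4x-2}{-x+4}\ge y$. Each of the four equivalences remains true if the remaining one of the three guards $X(x),Y(y),Z(z)$ is added. (c) A set $G$ of at most $3$ points is a set of boundary guards that guards the whole boundary of $P$ if and only if $G=\{X(x),Y(y),Z(z)\}$ for some $x\in I_x$, $y\in I_y$, $z\in I_z$ that satisfy the four constraints. (d) Consequently these constraints force $x=y=z=\sqrt2$: the set $\{X(\sqrt2),Y(\sqrt2),Z(\sqrt2)\}$ is the only set of at most $3$ boundary guards that guards the boundary of $P$. It has exactly $3$ elements, and each of them has an irrational coordinate. -/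

import Mathlib

/-- A polygon in the plane is simple if it has at least three vertices, the vertices are pairwise
distinct, and two different edges meet at most in common end points. -/
def Polygon.IsSimplePlane {n : ℕ} (P : Polygon (ℝ × ℝ) n) : Prop :=
  3 ≤ n ∧ Function.Injective P.vertices ∧
    ∀ i j : Fin n, i ≠ j →
      P.edgeSet ℝ i ∩ P.edgeSet ℝ j ⊆
        ({P i, P (finRotate n i)} : Set (ℝ × ℝ)) ∩ {P j, P (finRotate n j)}

/-- All vertices of the polygon have integer coordinates. -/
def Polygon.HasIntegerVertices {n : ℕ} (P : Polygon (ℝ × ℝ) n) : Prop :=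
  ∀ i : Fin n, ∃ a b : ℤ, P i = ((a : ℝ), (b : ℝ))

/-- The closed region enclosed by a polygon: its boundary together with the points whose connected
component in the complement of the boundary is bounded. -/
def Polygon.closedRegion {n : ℕ} (P : Polygon (ℝ × ℝ) n) : Set (ℝ × ℝ) :=
  {p | p ∈ P.boundary ℝ ∨ Bornology.IsBounded (connectedComponentIn (P.boundary ℝ)ᶜ p)}

/-- Two points see each other in the polygon if the line segment between them lies in it. -/
def Polygon.Sees {n : ℕ} (P : Polygon (ℝ × ℝ) n) (p q : ℝ × ℝ) : Prop :=
  segment ℝ p q ⊆ P.closedRegion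

/-- Every point of `T` is seen by at least one guard in `G`. -/
def Polygon.Guards {n : ℕ} (P : Polygon (ℝ × ℝ) n) (G T : Set (ℝ × ℝ)) : Prop :=
  ∀ t ∈ T, ∃ g ∈ G, P.Sees g t

/-- `G` is a set of guards placed on the boundary which together see the whole boundary. -/
def Polygon.IsBoundaryGuarding {n : ℕ} (P : Polygon (ℝ × ℝ) n) (G : Set (ℝ × ℝ)) : Prop :=
  G ⊆ P.boundary ℝ ∧ P.Guards G (P.boundary ℝ)

/-- The three consecutive edges of the polygon starting at the vertex with index `s`. -/
def Polygon.threeEdges {n : ℕ} (P : Polygon (ℝ × ℝ) n) (s : Fin n) : Set (ℝ × ℝ) :=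
  P.edgeSet ℝ s ∪ P.edgeSet ℝ (finRotate n s) ∪ P.edgeSet ℝ (finRotate n (finRotate n s))

/-- Four consecutive vertices (the first one with index `s`) form a nook if the open segment
joining the first to the last one (the mouth of the nook) lies in the interior of the polygon.
The walls of the nook are the three edges `P.threeEdges s`. -/
def Polygon.IsNook {n : ℕ} (P : Polygon (ℝ × ℝ) n) (s : Fin n) : Prop :=
  openSegment ℝ (P s) (P (finRotate n (finRotate n (finRotate n s)))) ⊆
    P.closedRegion \ P.boundary ℝ

/-- The condition `C` is exactly what the nook starting at `s` demands from the guards at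
`g₁` and `g₂`: these two guards see the walls of the nook if and only if `C` holds, and the presence
of the third guard at `g₃` does not change this. -/
def Polygon.NookImposes {n : ℕ} (P : Polygon (ℝ × ℝ) n) (s : Fin n) (g₁ g₂ g₃ : ℝ × ℝ)
    (C : Prop) : Prop :=
  (P.Guards {g₁, g₂} (P.threeEdges s) ↔ C) ∧ (P.Guards {g₁, g₂, g₃} (P.threeEdges s) ↔ C)

/-- The position of a guard representing the value `x`, in a drawing scaled by `N`. -/
noncomputable def guardX (N : ℕ) (x : ℝ) : ℝ × ℝ := (N : ℝ) • (-x, 0)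

/-- The position of a guard representing the value `y`, in a drawing scaled by `N`. -/
noncomputable def guardY (N : ℕ) (y : ℝ) : ℝ × ℝ := (N : ℝ) • (3 / 2 + 1 / 2 * y, 1 + y)

/-- The position of a guard representing the value `z`, in a drawing scaled by `N`. -/
noncomputable def guardZ (N : ℕ) (z : ℝ) : ℝ × ℝ := (N : ℝ) • (3 / 2 + 1 / 2 * z, -1 - z)

/-- The conjunction of the four constraints created by the nooks. -/
def NookConstraints (x y z : ℝ) : Prop :=
  z ≥ x ∧ y ≥ z ∧ (4 * x + 2) / (x + 4) ≥ y ∧ (4 * x - 2) / (-x + 4) ≥ y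

/-! The algebra is short. From `z ≥ x` and `y ≥ z` one gets `y ≥ x`; then the third constraint gives
`x² ≤ 2` and the fourth `x² ≥ 2`, so `x² = 2`, and `y` and `z` are squeezed onto `x`
(`nookConstraints_iff`).

The geometry is an explicit 26-gon `vert` at scale 600. The base of a nook is its middle edge. Of
two guards looking into a nook, one misses only the part of the base hidden behind the last vertex
of the nook, the other only the part hidden behind the first. The nooks are shaped so that both
shadows end at the same base point exactly when the constraint is an equality. On one side of
equality the guards cover the base (`covers_base_22` and its analogues); on the other side the
shadows overlap, and a base point in the overlap is unseen (`le_of_guards_22` and its analogues).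

That three guards must stand on the three intended edges follows from six test points on bases of
nooks (`sightCone_vert`). Each is visible only from the walls of its own nook and from inner points
of one of these edges (`mem_walls_or_mem_innerEdge_of_sees`). A hitting-set count (`three_zones`)
then leaves exactly one guard on each of the three edges, and the nooks do the rest.

All visibility claims reduce to signs of integer determinants, decided by evaluation. A line of
sight is blocked when it enters a half-strip that runs to infinity without meeting the boundary
(`not_mem_closedRegion_of_mem_strip`). A convex set lies in the polygon when every point of it off
the boundary is joined, without meeting the boundary, to a point of a bounded triangulated region
(`hull_subset_closedRegion`). -/

namespace ArtGallery

section

/-! ### Orientation of triples of points -/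

/-- Twice the signed area of the triangle `a b p`. -/
def orient (a b p : ℝ × ℝ) : ℝ := (b.1 - a.1) * (p.2 - a.2) - (b.2 - a.2) * (p.1 - a.1)

/-- Twice the signed area of a triangle with integer vertices. -/
def zorient (a b p : ℤ × ℤ) : ℤ := (b.1 - a.1) * (p.2 - a.2) - (b.2 - a.2) * (p.1 - a.1)

/-- The point of the plane with the given integer coordinates. -/
def pt (p : ℤ × ℤ) : ℝ × ℝ := ((p.1 : ℝ), (p.2 : ℝ))

/-- The point dividing the segment from `p` to `q` at the parameter `t`. -/
def comb (t : ℝ) (p q : ℝ × ℝ) : ℝ × ℝ := ((1 - t) * p.1 + t * q.1, (1 - t) * p.2 + t * q.2)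

theorem pt_add (a d : ℤ × ℤ) : pt (a + d) = pt a + pt d := by
  ext <;> simp [pt]

theorem pt_injective : Function.Injective pt := by
  rintro ⟨a, b⟩ ⟨c, d⟩ h
  simpa [pt] using h

theorem orient_pt (a b p : ℤ × ℤ) : orient (pt a) (pt b) (pt p) = (zorient a b p : ℝ) := by
  simp [orient, zorient, pt]

theorem orient_comb (a b p q : ℝ × ℝ) (t : ℝ) :
    orient a b (comb t p q) = (1 - t) * orient a b p + t * orient a b q := by
  simp only [orient, comb]; ring

theorem orient_rotate (a b p : ℝ × ℝ) : orient a b p = orient b p a := by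
  simp only [orient]; ring

theorem orient_swap (a b p : ℝ × ℝ) : orient a b p = -orient b a p := by
  simp only [orient]; ring

theorem orient_self_left (a p : ℝ × ℝ) : orient a p a = 0 := by
  simp only [orient]; ring

theorem orient_self_right (a p : ℝ × ℝ) : orient a p p = 0 := by
  simp only [orient]; ring

theorem comb_eq (t : ℝ) (p q : ℝ × ℝ) : comb t p q = (1 - t) • p + t • q := by
  ext <;> simp [comb]

theorem mem_segment_iff_comb {p q x : ℝ × ℝ} :
    x ∈ segment ℝ p q ↔ ∃ t, 0 ≤ t ∧ t ≤ 1 ∧ x = comb t p q := by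
  rw [segment_eq_image]
  constructor
  · rintro ⟨t, ⟨h0, h1⟩, rfl⟩
    exact ⟨t, h0, h1, (comb_eq t p q).symm⟩
  · rintro ⟨t, h0, h1, rfl⟩
    exact ⟨t, ⟨h0, h1⟩, (comb_eq t p q).symm⟩

theorem comb_mem_segment {t : ℝ} (p q : ℝ × ℝ) (h0 : 0 ≤ t) (h1 : t ≤ 1) :
    comb t p q ∈ segment ℝ p q :=
  mem_segment_iff_comb.2 ⟨t, h0, h1, rfl⟩

theorem comb_zero (p q : ℝ × ℝ) : comb 0 p q = p := by ext <;> simp [comb]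

theorem comb_one (p q : ℝ × ℝ) : comb 1 p q = q := by ext <;> simp [comb]

theorem comb_comb_right (s t : ℝ) (p q : ℝ × ℝ) :
    comb s (comb t p q) q = comb (t + s * (1 - t)) p q := by
  ext <;> simp only [comb] <;> ring

theorem continuous_orient (a b : ℝ × ℝ) : Continuous (orient a b) := by
  unfold orient; fun_prop

theorem continuous_comb (p q : ℝ × ℝ) : Continuous fun t => comb t p q := by
  unfold comb; fun_prop

/-- The segments `p q` and `a b` cross, with explicit parameters for the crossing point. -/
theorem comb_eq_comb_of_crossing {a b p q : ℝ × ℝ} (hD : orient a b p - orient a b q ≠ 0) :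
    comb (orient a b p / (orient a b p - orient a b q)) p q =
      comb (-orient p q a / (orient a b p - orient a b q)) a b := by
  have hD' := hD
  ext <;> simp only [comb] <;> field_simp <;> simp only [orient] <;> ring

theorem orient_sub_orient (a b p q : ℝ × ℝ) :
    orient a b p - orient a b q = orient p q b - orient p q a := by
  simp only [orient]; ring

/-- Barycentric coordinates, applied to an affine functional. -/
theorem orient_barycentric (a b c p u v : ℝ × ℝ) :
    orient a b c * orient u v p =
      orient b c p * orient u v a + orient c a p * orient u v b + orient a b p * orient u v c := by
  simp only [orient]; ring

/-! ### Polygons with integer vertices -/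

variable {m : ℕ}

/-- The polygon with the given integer vertices. -/
def gallery (V : Fin (m + 1) → ℤ × ℤ) : Polygon (ℝ × ℝ) (m + 1) := ⟨fun i => pt (V i)⟩

theorem edgeSet_gallery (V : Fin (m + 1) → ℤ × ℤ) (i : Fin (m + 1)) :
    (gallery V).edgeSet ℝ i = segment ℝ (pt (V i)) (pt (V (i + 1))) := by
  simp [Polygon.edgeSet, gallery, affineSegment_eq_segment, finRotate_apply]

theorem mem_boundary_iff {V : Fin (m + 1) → ℤ × ℤ} {p : ℝ × ℝ} :
    p ∈ (gallery V).boundary ℝ ↔ ∃ i, p ∈ segment ℝ (pt (V i)) (pt (V (i + 1))) := by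
  simp [Polygon.boundary, edgeSet_gallery]

/-! ### Points outside the closed region -/

/-- The half-strip that starts at the edge `i` and extends to the right of this edge in the
direction `d` misses the boundary. -/
def StripFree (V : Fin (m + 1) → ℤ × ℤ) (i : Fin (m + 1)) (d : ℤ × ℤ) : Prop :=
  zorient (V i) (V (i + 1)) (V i + d) < 0 ∧
  ∀ j : Fin (m + 1), ∃ f ∈ [(V (i + 1), V i), (V i, V i + d), (V (i + 1) + d, V (i + 1)),
      (V j, V (j + 1)), (V (j + 1), V j)],
    zorient f.1 f.2 (V j) ≤ 0 ∧ zorient f.1 f.2 (V (j + 1)) ≤ 0 ∧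
    0 ≤ zorient f.1 f.2 (V i) ∧ 0 ≤ zorient f.1 f.2 (V (i + 1)) ∧
    zorient f.1 f.2 (V i) ≤ zorient f.1 f.2 (V i + d) ∧
    (0 < zorient f.1 f.2 (V i) ∨ 0 < zorient f.1 f.2 (V (i + 1)) ∨
      zorient f.1 f.2 (V i) < zorient f.1 f.2 (V i + d))

/-- The open half-strip to the right of the edge `i` in direction `d`. -/
def strip (V : Fin (m + 1) → ℤ × ℤ) (i : Fin (m + 1)) (d : ℤ × ℤ) : Set (ℝ × ℝ) :=
  {p | orient (pt (V i)) (pt (V (i + 1))) p < 0 ∧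
    0 < orient (pt (V i)) (pt (V i + d)) p ∧
    orient (pt (V (i + 1))) (pt (V (i + 1) + d)) p < 0}

theorem strip_disjoint_boundary {V : Fin (m + 1) → ℤ × ℤ} {i : Fin (m + 1)} {d : ℤ × ℤ}
    (h : StripFree V i d) {p : ℝ × ℝ} (hp : p ∈ strip V i d) :
    p ∉ (gallery V).boundary ℝ := by
  obtain ⟨hD, hj⟩ := h
  obtain ⟨h1, h2, h3⟩ := hp
  rw [mem_boundary_iff]
  rintro ⟨j, hpj⟩
  obtain ⟨t, ht0, ht1, rfl⟩ := mem_segment_iff_comb.1 hpj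
  obtain ⟨f, -, hc, he, ha, hb, hd, hs⟩ := hj j
  set p := comb t (pt (V j)) (pt (V (j + 1)))
  have hfp : orient (pt f.1) (pt f.2) p ≤ 0 := by
    rw [orient_comb, orient_pt, orient_pt]
    have hc' : (zorient f.1 f.2 (V j) : ℝ) ≤ 0 := by exact_mod_cast hc
    have he' : (zorient f.1 f.2 (V (j + 1)) : ℝ) ≤ 0 := by exact_mod_cast he
    nlinarith
  -- Up to the factor `-D`, the three functionals that define the strip are the coordinates of `p`
  -- in the affine frame given by the edge `i` and the direction `d`. So `f` at `p` is a combination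
  -- of its values at the ends of the edge and its increment along `d`, with positive weights.
  have key : -orient (pt (V i)) (pt (V (i + 1))) (pt (V i + d)) * orient (pt f.1) (pt f.2) p =
      orient (pt f.1) (pt f.2) (pt (V i)) * (-orient (pt (V (i + 1))) (pt (V (i + 1) + d)) p) +
      orient (pt f.1) (pt f.2) (pt (V (i + 1))) * orient (pt (V i)) (pt (V i + d)) p +
      (orient (pt f.1) (pt f.2) (pt (V i + d)) - orient (pt f.1) (pt f.2) (pt (V i))) *
        (-orient (pt (V i)) (pt (V (i + 1))) p) := by
    simp only [orient, pt_add, Prod.fst_add, Prod.snd_add]; ring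
  simp only [orient_pt] at key
  have hD' : (zorient (V i) (V (i + 1)) (V i + d) : ℝ) < 0 := by exact_mod_cast hD
  have ha' : (0 : ℝ) ≤ zorient f.1 f.2 (V i) := by exact_mod_cast ha
  have hb' : (0 : ℝ) ≤ zorient f.1 f.2 (V (i + 1)) := by exact_mod_cast hb
  have hd' : (0 : ℝ) ≤ zorient f.1 f.2 (V i + d) - zorient f.1 f.2 (V i) := by
    rw [sub_nonneg]; exact_mod_cast hd
  have e1 := mul_nonneg ha' (neg_nonneg.2 h3.le)
  have e2 := mul_nonneg hb' h2.le
  have e3 := mul_nonneg hd' (neg_nonneg.2 h1.le)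
  have e0 := mul_nonpos_of_nonneg_of_nonpos (neg_nonneg.2 hD'.le) hfp
  rcases hs with hs | hs | hs
  · have : (0 : ℝ) < zorient f.1 f.2 (V i) := by exact_mod_cast hs
    have := mul_pos this (neg_pos.2 h3)
    linarith
  · have : (0 : ℝ) < zorient f.1 f.2 (V (i + 1)) := by exact_mod_cast hs
    have := mul_pos this h2
    linarith
  · have : (0 : ℝ) < zorient f.1 f.2 (V i + d) - zorient f.1 f.2 (V i) := by
      rw [sub_pos]; exact_mod_cast hs
    have := mul_pos this (neg_pos.2 h1)
    linarith

theorem add_smul_mem_strip {V : Fin (m + 1) → ℤ × ℤ} {i : Fin (m + 1)} {d : ℤ × ℤ}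
    (h : StripFree V i d) {p : ℝ × ℝ} (hp : p ∈ strip V i d) {t : ℝ} (ht : 0 ≤ t) :
    p + t • pt d ∈ strip V i d := by
  obtain ⟨h1, h2, h3⟩ := hp
  have hD : orient (pt (V i)) (pt (V (i + 1))) (pt (V i + d)) < 0 := by
    rw [orient_pt]; exact_mod_cast h.1
  refine ⟨?_, ?_, ?_⟩
  · have : orient (pt (V i)) (pt (V (i + 1))) (p + t • pt d) =
        orient (pt (V i)) (pt (V (i + 1))) p +
          t * orient (pt (V i)) (pt (V (i + 1))) (pt (V i + d)) := by
      simp [orient, pt_add]; ring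
    rw [this]
    nlinarith
  · refine h2.trans_eq ?_
    simp [orient, pt_add]; ring
  · refine Eq.trans_lt ?_ h3
    simp [orient, pt_add]; ring

/-- The ray from `p` in direction `d` stays in the strip, hence in a single component of the
complement of the boundary, which is therefore unbounded. No Jordan curve theorem is needed. -/
theorem not_mem_closedRegion_of_mem_strip {V : Fin (m + 1) → ℤ × ℤ} {i : Fin (m + 1)}
    {d : ℤ × ℤ} (h : StripFree V i d) {p : ℝ × ℝ} (hp : p ∈ strip V i d) :
    p ∉ (gallery V).closedRegion := by
  have hray : IsPreconnected ((fun t : ℝ => p + t • pt d) '' Set.Ici 0) :=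
    (convex_Ici (0 : ℝ)).isPreconnected.image _ (by fun_prop)
  have hsub : (fun t : ℝ => p + t • pt d) '' Set.Ici 0 ⊆
      connectedComponentIn ((gallery V).boundary ℝ)ᶜ p := by
    refine hray.subset_connectedComponentIn ⟨0, by simp, by simp⟩ ?_
    rintro _ ⟨t, ht, rfl⟩
    exact strip_disjoint_boundary h (add_smul_mem_strip h hp ht)
  rintro (hb | hb)
  · exact strip_disjoint_boundary h hp hb
  · have hd : pt d ≠ 0 := by
      intro h0
      have h1 := h.1
      have : d = 0 := pt_injective (by rw [h0]; ext <;> simp [pt])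
      subst this
      simp [zorient] at h1
    obtain ⟨C, hC⟩ := (hb.subset hsub).exists_norm_le
    have hn : 0 < ‖pt d‖ := norm_pos_iff.2 hd
    have hpC := hC p ⟨0, by simp, by simp⟩
    -- At this parameter the ray has moved by `2 * C + 1` from a point of norm at most `C`, so it
    -- has left the ball of radius `C`.
    have h2 := hC _ ⟨(2 * C + 1) / ‖pt d‖, by
      have := (norm_nonneg p).trans hpC
      simp only [Set.mem_Ici]; positivity, rfl⟩
    have hC0 := (norm_nonneg p).trans hpC
    have h3 : ‖((2 * C + 1) / ‖pt d‖) • pt d‖ = 2 * C + 1 := by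
      rw [norm_smul, Real.norm_of_nonneg (by positivity), div_mul_cancel₀ _ hn.ne']
    have h4 : ‖((2 * C + 1) / ‖pt d‖) • pt d‖ ≤
        ‖p + ((2 * C + 1) / ‖pt d‖) • pt d‖ + ‖p‖ := by
      simpa [norm_sub_rev] using norm_sub_le (p + ((2 * C + 1) / ‖pt d‖) • pt d) p
    simp only at h2
    linarith

/-! ### Obstructed lines of sight -/

theorem sees_comm {n : ℕ} {P : Polygon (ℝ × ℝ) n} {p q : ℝ × ℝ} : P.Sees p q ↔ P.Sees q p := by
  rw [Polygon.Sees, Polygon.Sees, segment_symm]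

/-- A line of sight that passes through a limit point of a free half-strip and then enters the
half-strip is obstructed. -/
theorem not_sees_of_enters_strip {V : Fin (m + 1) → ℤ × ℤ} {i : Fin (m + 1)} {d : ℤ × ℤ}
    (h : StripFree V i d) {p q x : ℝ × ℝ} (hx : x ∈ segment ℝ p q)
    (h1 : orient (pt (V i)) (pt (V (i + 1))) x = 0)
    (h1' : orient (pt (V i)) (pt (V (i + 1))) q < 0)
    (h2 : 0 < orient (pt (V i)) (pt (V i + d)) x ∨
      orient (pt (V i)) (pt (V i + d)) x = 0 ∧ 0 < orient (pt (V i)) (pt (V i + d)) q)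
    (h3 : orient (pt (V (i + 1))) (pt (V (i + 1) + d)) x < 0 ∨
      orient (pt (V (i + 1))) (pt (V (i + 1) + d)) x = 0 ∧
        orient (pt (V (i + 1))) (pt (V (i + 1) + d)) q < 0) :
    ¬ (gallery V).Sees p q := by
  intro hs
  -- The point `x` need not lie in the open strip, but the points just after it on the way to `q`
  -- do: strict inequalities persist by continuity, and a functional that vanishes at `x` takes the
  -- sign it has at `q`.
  have hcont : ∀ a b, Filter.Tendsto (fun t => orient a b (comb t x q))
      (nhdsWithin 0 (Set.Ioi 0)) (nhds (orient a b x)) := by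
    intro a b
    have := ((continuous_orient a b).comp (continuous_comb x q)).tendsto 0
    simp only [Function.comp_apply, comb_zero] at this
    exact this.mono_left nhdsWithin_le_nhds
  have hpos : ∀ᶠ t in nhdsWithin (0 : ℝ) (Set.Ioi 0), 0 < t := self_mem_nhdsWithin
  have hlt : ∀ᶠ t in nhdsWithin (0 : ℝ) (Set.Ioi 0), t < 1 :=
    nhdsWithin_le_nhds (gt_mem_nhds one_pos)
  have e2 : ∀ᶠ t in nhdsWithin (0 : ℝ) (Set.Ioi 0),
      0 < orient (pt (V i)) (pt (V i + d)) (comb t x q) := by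
    rcases h2 with h2 | ⟨h2, h2'⟩
    · exact (hcont _ _).eventually_const_lt h2
    · filter_upwards [hpos] with t ht
      rw [orient_comb, h2]; nlinarith
  have e3 : ∀ᶠ t in nhdsWithin (0 : ℝ) (Set.Ioi 0),
      orient (pt (V (i + 1))) (pt (V (i + 1) + d)) (comb t x q) < 0 := by
    rcases h3 with h3 | ⟨h3, h3'⟩
    · exact (hcont _ _).eventually_lt_const h3
    · filter_upwards [hpos] with t ht
      rw [orient_comb, h3]; nlinarith
  obtain ⟨t, ht0, ht1, ht2, ht3⟩ := (hpos.and (hlt.and (e2.and e3))).exists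
  refine not_mem_closedRegion_of_mem_strip h (p := comb t x q) ⟨?_, ht2, ht3⟩ (hs ?_)
  · rw [orient_comb, h1]; nlinarith
  · obtain ⟨s, hs0, hs1, rfl⟩ := mem_segment_iff_comb.1 hx
    rw [comb_comb_right]
    refine comb_mem_segment _ _ ?_ ?_ <;> nlinarith

/-- A line of sight that crosses an edge from the left to the right is obstructed. -/
theorem not_sees_of_crosses {V : Fin (m + 1) → ℤ × ℤ} {i : Fin (m + 1)} {d : ℤ × ℤ}
    (h : StripFree V i d) {p q : ℝ × ℝ}
    (hp : 0 ≤ orient (pt (V i)) (pt (V (i + 1))) p)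
    (hq : orient (pt (V i)) (pt (V (i + 1))) q < 0)
    (ha : orient p q (pt (V i)) < 0) (hb : 0 < orient p q (pt (V (i + 1)))) :
    ¬ (gallery V).Sees p q := by
  have hD : 0 < orient (pt (V i)) (pt (V (i + 1))) p - orient (pt (V i)) (pt (V (i + 1))) q := by
    linarith
  have hD2 := orient_sub_orient (pt (V i)) (pt (V (i + 1))) p q
  have hd : orient (pt (V i)) (pt (V (i + 1))) (pt (V i + d)) < 0 := by
    rw [orient_pt]; exact_mod_cast h.1
  have hx := comb_eq_comb_of_crossing (a := pt (V i)) (b := pt (V (i + 1))) (p := p) (q := q) hD.ne'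
  set D := orient (pt (V i)) (pt (V (i + 1))) p - orient (pt (V i)) (pt (V (i + 1))) q
  have hs0 : 0 < -orient p q (pt (V i)) / D := div_pos (by linarith) hD
  have hs1 : -orient p q (pt (V i)) / D < 1 := by rw [div_lt_one hD]; linarith
  have ed : orient (pt (V i)) (pt (V i + d)) (pt (V (i + 1))) =
      -orient (pt (V i)) (pt (V (i + 1))) (pt (V i + d)) := by
    simp only [orient]; ring
  have ed' : orient (pt (V (i + 1))) (pt (V (i + 1) + d)) (pt (V i)) =
      orient (pt (V i)) (pt (V (i + 1))) (pt (V i + d)) := by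
    simp only [orient, pt_add, Prod.fst_add, Prod.snd_add]; ring
  -- By `hs0` and `hs1` the crossing point is an inner point of the edge, so it lies strictly
  -- between the two sides of the half-strip.
  refine not_sees_of_enters_strip h (x := comb (-orient p q (pt (V i)) / D) (pt (V i))
    (pt (V (i + 1)))) ?_ ?_ hq (Or.inl ?_) (Or.inl ?_)
  · rw [← hx]
    exact comb_mem_segment _ _ (div_nonneg hp hD.le) (by rw [div_le_one hD]; simp only [D]; linarith)
  · rw [orient_comb, orient_self_left, orient_self_right]; ring
  · rw [orient_comb, orient_self_left, ed]; nlinarith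
  · rw [orient_comb, orient_self_left, ed']; nlinarith

end

section

variable {m : ℕ}

/-! ### Triangulated polygons -/

/-- The closed triangle with the given vertices in counterclockwise order. -/
def tri (a b c : ℝ × ℝ) : Set (ℝ × ℝ) :=
  {p | 0 ≤ orient a b p ∧ 0 ≤ orient b c p ∧ 0 ≤ orient c a p}

theorem tri_rotate (a b c : ℝ × ℝ) : tri a b c = tri b c a := by
  ext p; simp only [tri, Set.mem_ofPred_eq]; tauto

/-- The indices of the vertices of a triangle. -/
structure Triple (n : ℕ) where
  /-- the first index -/
  fst : Fin n
  /-- the second index -/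
  snd : Fin n
  /-- the third index -/
  trd : Fin n

/-- The union of the triangles whose vertices are listed in `T`. -/
def triRegion (V : Fin (m + 1) → ℤ × ℤ)
    (T : List (Triple (m + 1))) : Set (ℝ × ℝ) :=
  {p | ∃ t ∈ T, p ∈ tri (pt (V t.fst)) (pt (V t.snd)) (pt (V t.trd))}

/-- A side of a triangle is an edge of the polygon, or a neighboring triangle continues across. -/
def SideMatched (T : List (Triple (m + 1))) (a b : Fin (m + 1)) : Prop :=
  b = a + 1 ∨ ∃ u ∈ T, (u.fst = b ∧ u.snd = a) ∨ (u.snd = b ∧ u.trd = a) ∨ (u.trd = b ∧ u.fst = a)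

/-- A list of positively oriented triangles whose sides are edges of the polygon or shared. -/
def Triangulation (V : Fin (m + 1) → ℤ × ℤ)
    (T : List (Triple (m + 1))) : Prop :=
  ∀ t ∈ T, 0 < zorient (V t.fst) (V t.snd) (V t.trd) ∧
    SideMatched T t.fst t.snd ∧ SideMatched T t.snd t.trd ∧ SideMatched T t.trd t.fst

variable {V : Fin (m + 1) → ℤ × ℤ} {T : List (Triple (m + 1))}

theorem isClosed_tri (a b c : ℝ × ℝ) : IsClosed (tri a b c) :=
  (isClosed_le continuous_const (continuous_orient a b)).inter
    ((isClosed_le continuous_const (continuous_orient b c)).inter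
      (isClosed_le continuous_const (continuous_orient c a)))

theorem triRegion_eq_iUnion : triRegion V T =
    ⋃ t ∈ {t | t ∈ T}, tri (pt (V t.fst)) (pt (V t.snd)) (pt (V t.trd)) := by
  ext p; simp [triRegion]

theorem isClosed_triRegion : IsClosed (triRegion V T) := by
  rw [triRegion_eq_iUnion]
  exact (List.finite_toSet T).isClosed_biUnion fun _ _ => isClosed_tri _ _ _

theorem barycentric_fst (a b c p : ℝ × ℝ) : orient a b c * p.1 =
    orient b c p * a.1 + orient c a p * b.1 + orient a b p * c.1 := by
  simp only [orient]; ring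

theorem barycentric_snd (a b c p : ℝ × ℝ) : orient a b c * p.2 =
    orient b c p * a.2 + orient c a p * b.2 + orient a b p * c.2 := by
  simp only [orient]; ring

theorem orient_sum (a b c p : ℝ × ℝ) :
    orient b c p + orient c a p + orient a b p = orient a b c := by
  simp only [orient]; ring

theorem tri_subset_convexHull {a b c : ℝ × ℝ} (h : 0 < orient a b c) :
    tri a b c ⊆ convexHull ℝ {a, b, c} := by
  rintro p ⟨h1, h2, h3⟩
  have hs := orient_sum a b c p
  have hp : p = (orient b c p / orient a b c) • a + (orient c a p / orient a b c) • b +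
      (orient a b p / orient a b c) • c := by
    have e1 := barycentric_fst a b c p
    have e2 := barycentric_snd a b c p
    ext
    · simp only [Prod.fst_add, Prod.smul_fst, smul_eq_mul]; field_simp; linarith
    · simp only [Prod.snd_add, Prod.smul_snd, smul_eq_mul]; field_simp; linarith
  have hc := (convex_convexHull ℝ {a, b, c}).sum_mem (t := Finset.univ)
    (w := ![orient b c p / orient a b c, orient c a p / orient a b c, orient a b p / orient a b c])
    (z := ![a, b, c])
  simp only [Finset.mem_univ, forall_const, Fin.forall_fin_succ, Fin.sum_univ_three,
    Matrix.cons_val_zero, Matrix.cons_val_one, Matrix.cons_val] at hc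
  rw [hp]
  refine hc ⟨div_nonneg h2 h.le, div_nonneg h3 h.le, by simpa using div_nonneg h1 h.le⟩ ?_
    ⟨subset_convexHull ℝ _ (by simp), subset_convexHull ℝ _ (by simp),
      by simpa using subset_convexHull ℝ {a, b, c} (by simp)⟩
  rw [← add_div, ← add_div, hs, div_self h.ne']

theorem isBounded_triRegion (hT : Triangulation V T) : Bornology.IsBounded (triRegion V T) := by
  rw [triRegion_eq_iUnion, Bornology.isBounded_biUnion (List.finite_toSet T)]
  intro t ht
  refine Bornology.IsBounded.subset ?_ (tri_subset_convexHull ?_)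
  · rw [isBounded_convexHull]; exact (Set.toFinite _).isBounded
  · rw [orient_pt]; exact_mod_cast (hT t ht).1

theorem tri_mem_nhds {a b c p : ℝ × ℝ} (h1 : 0 < orient a b p) (h2 : 0 < orient b c p)
    (h3 : 0 < orient c a p) : tri a b c ∈ nhds p := by
  have e : ∀ u v, 0 < orient u v p → ∀ᶠ q in nhds p, 0 ≤ orient u v q := fun u v h =>
    (((continuous_orient u v).tendsto p).eventually_const_lt h).mono fun _ => le_of_lt
  filter_upwards [e a b h1, e b c h2, e c a h3] with q q1 q2 q3
  exact ⟨q1, q2, q3⟩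

theorem tri_subset_triRegion {t} (ht : t ∈ T) :
    tri (pt (V t.fst)) (pt (V t.snd)) (pt (V t.trd)) ⊆ triRegion V T :=
  fun _ hp => ⟨t, ht, hp⟩

theorem SideMatched.exists_neighbor (hT : Triangulation V T) {a b : Fin (m + 1)}
    (h : SideMatched T a b) : b = a + 1 ∨ ∃ c, 0 < orient (pt (V b)) (pt (V a)) (pt (V c)) ∧
      tri (pt (V b)) (pt (V a)) (pt (V c)) ⊆ triRegion V T := by
  rcases h with h | ⟨u, hu, h⟩
  · exact Or.inl h
  · have hu1 : 0 < orient (pt (V u.fst)) (pt (V u.snd)) (pt (V u.trd)) := by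
      rw [orient_pt]; exact_mod_cast (hT u hu).1
    have hsub := tri_subset_triRegion (V := V) hu
    right
    rcases h with ⟨rfl, rfl⟩ | ⟨rfl, rfl⟩ | ⟨rfl, rfl⟩
    · exact ⟨_, hu1, hsub⟩
    · exact ⟨u.fst, by rwa [← orient_rotate], by rwa [← tri_rotate]⟩
    · exact ⟨u.snd, by rwa [orient_rotate], by rwa [tri_rotate]⟩

/-- Since `p` is an inner point of the side `a b` and not on the boundary, this side is no edge, so
another triangle of the list lies across it. Near `p` each point lies in one of the two triangles,
according to its side of the line `a b`. -/
theorem triRegion_mem_nhds_of_side (hT : Triangulation V T) {a b c : Fin (m + 1)}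
    (hpos : 0 < orient (pt (V a)) (pt (V b)) (pt (V c)))
    (hsub : tri (pt (V a)) (pt (V b)) (pt (V c)) ⊆ triRegion V T)
    (hm : SideMatched T a b) {p : ℝ × ℝ} (hp : p ∉ (gallery V).boundary ℝ)
    (h1 : orient (pt (V a)) (pt (V b)) p = 0) (h2 : 0 < orient (pt (V b)) (pt (V c)) p)
    (h3 : 0 < orient (pt (V c)) (pt (V a)) p) : triRegion V T ∈ nhds p := by
  rcases hm.exists_neighbor hT with rfl | ⟨c', hpos', hsub'⟩
  · refine absurd (mem_boundary_iff.2 ⟨a, mem_segment_iff_comb.2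
      ⟨orient (pt (V c)) (pt (V a)) p / orient (pt (V a)) (pt (V (a + 1))) (pt (V c)),
        by positivity, ?_, ?_⟩⟩) hp
    · have hs := orient_sum (pt (V a)) (pt (V (a + 1))) (pt (V c)) p
      rw [div_le_one hpos]; linarith
    · have e1 := barycentric_fst (pt (V a)) (pt (V (a + 1))) (pt (V c)) p
      have e2 := barycentric_snd (pt (V a)) (pt (V (a + 1))) (pt (V c)) p
      have hs := orient_sum (pt (V a)) (pt (V (a + 1))) (pt (V c)) p
      rw [h1] at e1 e2 hs
      have hs' : orient (pt (V (a + 1))) (pt (V c)) p =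
        orient (pt (V a)) (pt (V (a + 1))) (pt (V c)) - orient (pt (V c)) (pt (V a)) p := by
        linarith
      rw [hs'] at e1 e2
      ext
      · simp only [comb]; field_simp; linarith
      · simp only [comb]; field_simp; linarith
  · have b1 := orient_barycentric (pt (V a)) (pt (V b)) (pt (V c)) p (pt (V a)) (pt (V c'))
    have b2 := orient_barycentric (pt (V a)) (pt (V b)) (pt (V c)) p (pt (V c')) (pt (V b))
    have r1 : 0 < orient (pt (V a)) (pt (V c')) (pt (V b)) := by rwa [← orient_rotate]
    have r2 : 0 < orient (pt (V c')) (pt (V b)) (pt (V a)) := by rwa [orient_rotate]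
    rw [h1, orient_self_left] at b1
    rw [h1, orient_self_right] at b2
    have s1 : 0 < orient (pt (V a)) (pt (V c')) p := by
      have := mul_pos h3 r1
      by_contra hn
      have := mul_nonpos_of_nonneg_of_nonpos hpos.le (not_lt.1 hn)
      linarith
    have s2 : 0 < orient (pt (V c')) (pt (V b)) p := by
      have := mul_pos h2 r2
      by_contra hn
      have := mul_nonpos_of_nonneg_of_nonpos hpos.le (not_lt.1 hn)
      linarith
    have e : ∀ u v, 0 < orient u v p → ∀ᶠ q in nhds p, 0 ≤ orient u v q := fun u v h =>
      (((continuous_orient u v).tendsto p).eventually_const_lt h).mono fun _ => le_of_lt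
    filter_upwards [e _ _ h2, e _ _ h3, e _ _ s1, e _ _ s2] with q q1 q2 q3 q4
    rcases le_total 0 (orient (pt (V a)) (pt (V b)) q) with hq | hq
    · exact hsub ⟨hq, q1, q2⟩
    · exact hsub' ⟨by rw [orient_swap]; linarith, q3, q4⟩

theorem vertex_mem_boundary (V : Fin (m + 1) → ℤ × ℤ) (i : Fin (m + 1)) :
    pt (V i) ∈ (gallery V).boundary ℝ :=
  mem_boundary_iff.2 ⟨i, left_mem_segment ℝ _ _⟩

theorem eq_of_orient_eq_zero {a b c p : ℝ × ℝ} (h : 0 < orient a b c) (h1 : orient a b p = 0)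
    (h2 : orient c a p = 0) : p = a := by
  have e1 := barycentric_fst a b c p
  have e2 := barycentric_snd a b c p
  have hs := orient_sum a b c p
  rw [h1, h2] at e1 e2 hs
  simp only [add_zero, zero_mul] at e1 e2 hs
  rw [hs] at e1 e2
  ext
  · exact mul_left_cancel₀ h.ne' e1
  · exact mul_left_cancel₀ h.ne' e2

/-- Vertices belong to the boundary, so at most one of the three side functionals can vanish at `p`:
it is inside a triangle or inside a side. -/
theorem triRegion_mem_nhds (hT : Triangulation V T) {p : ℝ × ℝ} (hpT : p ∈ triRegion V T)
    (hp : p ∉ (gallery V).boundary ℝ) : triRegion V T ∈ nhds p := by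
  obtain ⟨⟨a, b, c⟩, ht, h1, h2, h3⟩ := hpT
  obtain ⟨hz, m1, m2, m3⟩ := hT _ ht
  have hsub := tri_subset_triRegion (V := V) ht
  simp only at h1 h2 h3 hz m1 m2 m3 hsub
  have hpos : 0 < orient (pt (V a)) (pt (V b)) (pt (V c)) := by
    rw [orient_pt]; exact_mod_cast hz
  have hne : ∀ i, p ≠ pt (V i) := by
    rintro i rfl; exact hp (vertex_mem_boundary V i)
  have hpos' : 0 < orient (pt (V b)) (pt (V c)) (pt (V a)) := by rwa [← orient_rotate]
  have hpos'' : 0 < orient (pt (V c)) (pt (V a)) (pt (V b)) := by rwa [orient_rotate]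
  rcases h1.eq_or_lt' with h1 | h1
  · have h2' := h2.lt_of_ne' fun h => hne _ (eq_of_orient_eq_zero hpos' h h1)
    have h3' := h3.lt_of_ne' fun h => hne _ (eq_of_orient_eq_zero hpos h1 h)
    exact triRegion_mem_nhds_of_side hT hpos hsub m1 hp h1 h2' h3'
  rcases h2.eq_or_lt' with h2 | h2
  · have h3' := h3.lt_of_ne' fun h => hne _ (eq_of_orient_eq_zero hpos'' h h2)
    exact triRegion_mem_nhds_of_side hT hpos' (by rwa [← tri_rotate]) m2 hp h2 h3' h1
  rcases h3.eq_or_lt' with h3 | h3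
  · exact triRegion_mem_nhds_of_side hT hpos'' (by rwa [tri_rotate]) m3 hp h3 h1 h2
  exact Filter.mem_of_superset (tri_mem_nhds h1 h2 h3) hsub

/-- A component of the complement of the boundary that meets the triangulated region is bounded. -/
theorem mem_closedRegion_of_component (hT : Triangulation V T) {w p : ℝ × ℝ}
    (hw : w ∈ triRegion V T) {S : Set (ℝ × ℝ)} (hS : IsPreconnected S)
    (hSB : S ⊆ ((gallery V).boundary ℝ)ᶜ) (hwS : w ∈ S) (hpS : p ∈ S) :
    p ∈ (gallery V).closedRegion := by
  right
  rw [← connectedComponentIn_eq (hS.subset_connectedComponentIn hwS hSB hpS)]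
  -- Within the component the interior of the triangulated region is open, and closed by
  -- `triRegion_mem_nhds`; it contains `w`, so it contains the whole component.
  refine (isBounded_triRegion hT).subset (Set.Subset.trans ?_ interior_subset)
  refine isPreconnected_connectedComponentIn.subset_of_closure_inter_subset isOpen_interior
    ⟨w, mem_connectedComponentIn (hSB hwS),
      mem_interior_iff_mem_nhds.2 (triRegion_mem_nhds hT hw (hSB hwS))⟩ ?_
  rintro x ⟨hx1, hx2⟩
  exact mem_interior_iff_mem_nhds.2 (triRegion_mem_nhds hT
    (isClosed_triRegion.closure_subset_iff.2 interior_subset hx1)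
    (connectedComponentIn_subset _ _ hx2))

/-! ### Convex sets of mutually visible points -/

/-- The interior of the convex hull of the points `ks`, as seen from `w`, misses the boundary. -/
def HullFree (V : Fin (m + 1) → ℤ × ℤ) (T : List (Triple (m + 1)))
    (ks : List (ℤ × ℤ)) (w : ℤ × ℤ) : Prop :=
  (∃ t ∈ T, 0 ≤ zorient (V t.fst) (V t.snd) w ∧ 0 ≤ zorient (V t.snd) (V t.trd) w ∧
    0 ≤ zorient (V t.trd) (V t.fst) w) ∧
  ∀ j : Fin (m + 1), ∃ f ∈ (V j, V (j + 1)) :: (V (j + 1), V j) :: ks ×ˢ ks,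
    zorient f.1 f.2 (V j) ≤ 0 ∧ zorient f.1 f.2 (V (j + 1)) ≤ 0 ∧ 0 < zorient f.1 f.2 w ∧
    ∀ k ∈ ks, 0 ≤ zorient f.1 f.2 k

/-- The convex hull of a list of integer points. -/
def hull (ks : List (ℤ × ℤ)) : Set (ℝ × ℝ) := convexHull ℝ (pt '' {k | k ∈ ks})

theorem orient_nonneg_of_mem_hull {ks : List (ℤ × ℤ)} {u v : ℤ × ℤ}
    (h : ∀ k ∈ ks, 0 ≤ zorient u v k) {p : ℝ × ℝ} (hp : p ∈ hull ks) :
    0 ≤ orient (pt u) (pt v) p := by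
  have hc : Convex ℝ {q | 0 ≤ orient (pt u) (pt v) q} := by
    intro x hx y hy a b ha hb hab
    simp only [Set.mem_ofPred_eq] at hx hy ⊢
    obtain rfl : a = 1 - b := by linarith
    rw [← comb_eq, orient_comb]
    positivity
  refine convexHull_min ?_ hc hp
  rintro _ ⟨k, hk, rfl⟩
  simp only [Set.mem_ofPred_eq, orient_pt]
  exact_mod_cast h k hk

/-- For each edge some functional is nonpositive on the edge, nonnegative on the hull and positive
at `w`. Before `p` is reached the weight of `w` is positive, so the functional is positive there. -/
theorem comb_notMem_boundary_of_hullFree {ks : List (ℤ × ℤ)} {w : ℤ × ℤ}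
    (h : HullFree V T ks w) {p : ℝ × ℝ} (hp : p ∈ hull ks) {t : ℝ} (ht0 : 0 ≤ t) (ht1 : t < 1) :
    comb t (pt w) p ∉ (gallery V).boundary ℝ := by
  rw [mem_boundary_iff]
  rintro ⟨j, hj⟩
  obtain ⟨f, -, h1, h2, hw, hk⟩ := h.2 j
  obtain ⟨s, hs0, hs1, hs⟩ := mem_segment_iff_comb.1 hj
  have e1 : 0 < orient (pt f.1) (pt f.2) (comb t (pt w) p) := by
    have := orient_nonneg_of_mem_hull hk hp
    have hw' : (0 : ℝ) < zorient f.1 f.2 w := by exact_mod_cast hw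
    rw [orient_comb, orient_pt]
    have := mul_pos (sub_pos.2 ht1) hw'
    positivity
  have h1' : (zorient f.1 f.2 (V j) : ℝ) ≤ 0 := by exact_mod_cast h1
  have h2' : (zorient f.1 f.2 (V (j + 1)) : ℝ) ≤ 0 := by exact_mod_cast h2
  rw [hs, orient_comb, orient_pt, orient_pt] at e1
  nlinarith

/-- The segment from `w` to a hull point off the boundary is a connected set that avoids the
boundary and meets the triangulated region. The triangles need not be known to fill the polygon. -/
theorem hull_subset_closedRegion (hT : Triangulation V T) {ks : List (ℤ × ℤ)} {w : ℤ × ℤ}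
    (h : HullFree V T ks w) : hull ks ⊆ (gallery V).closedRegion := by
  intro p hp
  by_cases hpB : p ∈ (gallery V).boundary ℝ
  · exact Or.inl hpB
  have hw : pt w ∈ triRegion V T := by
    obtain ⟨⟨t, ht, h1, h2, h3⟩, -⟩ := h
    refine ⟨t, ht, ?_, ?_, ?_⟩ <;> rw [orient_pt] <;> assumption_mod_cast
  refine mem_closedRegion_of_component hT hw (S := segment ℝ (pt w) p)
    (convex_segment _ _).isPreconnected ?_ (left_mem_segment ℝ _ _) (right_mem_segment ℝ _ _)
  intro x hx
  obtain ⟨t, ht0, ht1, rfl⟩ := mem_segment_iff_comb.1 hx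
  rcases ht1.eq_or_lt with rfl | ht1
  · rwa [comb_one]
  · exact comb_notMem_boundary_of_hullFree h hp ht0 ht1

theorem convex_hull (ks : List (ℤ × ℤ)) : Convex ℝ (hull ks) := convex_convexHull _ _

theorem pt_mem_hull {ks : List (ℤ × ℤ)} {k : ℤ × ℤ} (hk : k ∈ ks) : pt k ∈ hull ks :=
  subset_convexHull _ _ ⟨k, hk, rfl⟩

theorem sees_of_mem_hull (hT : Triangulation V T) {ks : List (ℤ × ℤ)} {w : ℤ × ℤ}
    (h : HullFree V T ks w) {p q : ℝ × ℝ} (hp : p ∈ hull ks) (hq : q ∈ hull ks) :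
    (gallery V).Sees p q :=
  ((convex_hull ks).segment_subset hp hq).trans (hull_subset_closedRegion hT h)

theorem segment_subset_hull {ks : List (ℤ × ℤ)} {k l : ℤ × ℤ} (hk : k ∈ ks) (hl : l ∈ ks) :
    segment ℝ (pt k) (pt l) ⊆ hull ks :=
  (convex_hull ks).segment_subset (pt_mem_hull hk) (pt_mem_hull hl)

end

/-- The vertices of the gallery. -/
def vert : Fin 26 → ℤ × ℤ :=
  ![(-1500, 0), (-720, 0), (1040, -3080), (981, -3594), (938, -5572), (1080, -3360),
    (1590, -1980), (1230, -1260), (1620, 453), (2400, 597), (2400, 603), (1740, 490), (1980, 600),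
    (2964, 760), (6669, 1710), (3000, 1200), (1800, 1500), (1883, 1530), (1971, 1610),
    (1860, 1560), (1530, 1860), (1200, 1200), (-2760, 1680), (-3250, 2100), (-4626, 3060),
    (-3000, 1800)]

/-- A triangulation of the gallery. -/
def triangles : List (Triple 26) :=
  [⟨25, 0, 1⟩, ⟨2, 3, 4⟩, ⟨2, 4, 5⟩, ⟨2, 5, 6⟩, ⟨1, 2, 6⟩, ⟨1, 6, 7⟩, ⟨25, 1, 7⟩, ⟨8, 9, 10⟩,
    ⟨8, 10, 11⟩, ⟨8, 11, 12⟩, ⟨12, 13, 14⟩, ⟨12, 14, 15⟩, ⟨8, 12, 15⟩, ⟨8, 15, 16⟩, ⟨7, 8, 16⟩,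
    ⟨16, 17, 18⟩, ⟨16, 18, 19⟩, ⟨16, 19, 20⟩, ⟨7, 16, 20⟩, ⟨7, 20, 21⟩, ⟨7, 21, 22⟩,
    ⟨25, 7, 22⟩, ⟨25, 22, 23⟩, ⟨23, 24, 25⟩]

theorem triangulation : Triangulation (m := 25) vert triangles := by
  unfold Triangulation SideMatched; decide +kernel

section

variable {m : ℕ} {V : Fin (m + 1) → ℤ × ℤ} {T : List (Triple (m + 1))}

/-! ### Disjoint edges, simple polygons and nooks -/

/-- A line through one of two edges separates them. -/
def EdgesApart (V : Fin (m + 1) → ℤ × ℤ) (i j : Fin (m + 1)) : Prop :=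
  ∃ f ∈ [(V i, V (i + 1)), (V (i + 1), V i), (V j, V (j + 1)), (V (j + 1), V j)],
    0 ≤ zorient f.1 f.2 (V i) ∧ 0 ≤ zorient f.1 f.2 (V (i + 1)) ∧
    zorient f.1 f.2 (V j) ≤ 0 ∧ zorient f.1 f.2 (V (j + 1)) ≤ 0 ∧
    ((0 < zorient f.1 f.2 (V i) ∧ 0 < zorient f.1 f.2 (V (i + 1))) ∨
      (zorient f.1 f.2 (V j) < 0 ∧ zorient f.1 f.2 (V (j + 1)) < 0))

theorem orient_nonneg_of_mem_segment {u v a b : ℤ × ℤ} (ha : 0 ≤ zorient u v a)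
    (hb : 0 ≤ zorient u v b) {p : ℝ × ℝ} (hp : p ∈ segment ℝ (pt a) (pt b)) :
    0 ≤ orient (pt u) (pt v) p := by
  obtain ⟨t, h0, h1, rfl⟩ := mem_segment_iff_comb.1 hp
  have ha' : (0 : ℝ) ≤ zorient u v a := by exact_mod_cast ha
  have hb' : (0 : ℝ) ≤ zorient u v b := by exact_mod_cast hb
  rw [orient_comb, orient_pt, orient_pt]
  exact add_nonneg (mul_nonneg (by linarith) ha') (mul_nonneg h0 hb')

theorem convexComb_pos {t x y : ℝ} (h0 : 0 ≤ t) (h1 : t ≤ 1) (hx : 0 < x) (hy : 0 < y) :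
    0 < (1 - t) * x + t * y := by
  rcases h0.eq_or_lt with rfl | h0
  · simpa using hx
  · exact add_pos_of_nonneg_of_pos (mul_nonneg (by linarith) hx.le) (mul_pos h0 hy)

theorem orient_pos_of_mem_segment {u v a b : ℤ × ℤ} (ha : 0 < zorient u v a)
    (hb : 0 < zorient u v b) {p : ℝ × ℝ} (hp : p ∈ segment ℝ (pt a) (pt b)) :
    0 < orient (pt u) (pt v) p := by
  obtain ⟨t, h0, h1, rfl⟩ := mem_segment_iff_comb.1 hp
  have ha' : (0 : ℝ) < zorient u v a := by exact_mod_cast ha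
  have hb' : (0 : ℝ) < zorient u v b := by exact_mod_cast hb
  rw [orient_comb, orient_pt, orient_pt]
  exact convexComb_pos h0 h1 ha' hb'

theorem zorient_swap (a b p : ℤ × ℤ) : zorient a b p = -zorient b a p := by
  simp only [zorient]; ring

theorem orient_nonpos_of_mem_segment {u v a b : ℤ × ℤ} (ha : zorient u v a ≤ 0)
    (hb : zorient u v b ≤ 0) {p : ℝ × ℝ} (hp : p ∈ segment ℝ (pt a) (pt b)) :
    orient (pt u) (pt v) p ≤ 0 := by
  rw [orient_swap, neg_nonpos]
  rw [zorient_swap] at ha hb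
  exact orient_nonneg_of_mem_segment (by linarith) (by linarith) hp

theorem orient_neg_of_mem_segment {u v a b : ℤ × ℤ} (ha : zorient u v a < 0)
    (hb : zorient u v b < 0) {p : ℝ × ℝ} (hp : p ∈ segment ℝ (pt a) (pt b)) :
    orient (pt u) (pt v) p < 0 := by
  rw [orient_swap, neg_lt_zero]
  rw [zorient_swap] at ha hb
  exact orient_pos_of_mem_segment (by linarith) (by linarith) hp

theorem EdgesApart.disjoint {i j : Fin (m + 1)} (h : EdgesApart V i j) :
    Disjoint (segment ℝ (pt (V i)) (pt (V (i + 1)))) (segment ℝ (pt (V j)) (pt (V (j + 1)))) := by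
  obtain ⟨f, -, h1, h2, h3, h4, h5⟩ := h
  rw [Set.disjoint_left]
  intro p hi hj
  rcases h5 with ⟨h5, h6⟩ | ⟨h5, h6⟩
  · exact (orient_pos_of_mem_segment h5 h6 hi).not_ge (orient_nonpos_of_mem_segment h3 h4 hj)
  · exact (orient_neg_of_mem_segment h5 h6 hj).not_ge (orient_nonneg_of_mem_segment h1 h2 hi)

theorem eq_of_mem_adjacent {a b c : ℤ × ℤ} (h : zorient a b c ≠ 0) {p : ℝ × ℝ}
    (h1 : p ∈ segment ℝ (pt a) (pt b)) (h2 : p ∈ segment ℝ (pt b) (pt c)) : p = pt b := by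
  obtain ⟨t, -, -, rfl⟩ := mem_segment_iff_comb.1 h2
  obtain ⟨s, -, -, hs⟩ := mem_segment_iff_comb.1 h1
  have e := congrArg (orient (pt a) (pt b)) hs
  have h' : (zorient a b c : ℝ) ≠ 0 := by exact_mod_cast h
  simp only [orient_comb, orient_self_left, orient_self_right, orient_pt a b c, mul_zero, add_zero,
    zero_add, mul_eq_zero, h', or_false] at e
  rw [e, comb_zero]

theorem isSimplePlane_gallery (h3 : 3 ≤ m + 1) (hinj : Function.Injective V)
    (hadj : ∀ i, zorient (V i) (V (i + 1)) (V (i + 1 + 1)) ≠ 0)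
    (hap : ∀ i j, i ≠ j → j ≠ i + 1 → i ≠ j + 1 → EdgesApart V i j) :
    (gallery V).IsSimplePlane := by
  refine ⟨h3, pt_injective.comp hinj, ?_⟩
  rintro i j hij p ⟨hi, hj⟩
  rw [edgeSet_gallery] at hi hj
  simp only [finRotate_apply]
  change p ∈ ({pt (V i), pt (V (i + 1))} : Set (ℝ × ℝ)) ∩ {pt (V j), pt (V (j + 1))}
  by_cases h1 : j = i + 1
  · subst h1
    rw [eq_of_mem_adjacent (hadj i) hi hj]; simp
  by_cases h2 : i = j + 1
  · subst h2
    rw [eq_of_mem_adjacent (hadj j) hj hi]; simp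
  exact absurd hj (Set.disjoint_left.1 (hap i j hij h1 h2).disjoint hi)

theorem threeEdges_gallery (s : Fin (m + 1)) : (gallery V).threeEdges s =
    segment ℝ (pt (V s)) (pt (V (s + 1))) ∪ segment ℝ (pt (V (s + 1))) (pt (V (s + 1 + 1))) ∪
      segment ℝ (pt (V (s + 1 + 1))) (pt (V (s + 1 + 1 + 1))) := by
  simp [Polygon.threeEdges, edgeSet_gallery, finRotate_apply]

theorem disjoint_threeEdges {s t : Fin (m + 1)}
    (h : ∀ i ∈ [s, s + 1, s + 1 + 1], ∀ j ∈ [t, t + 1, t + 1 + 1], EdgesApart V i j) :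
    Disjoint ((gallery V).threeEdges s) ((gallery V).threeEdges t) := by
  simp only [threeEdges_gallery, Set.disjoint_union_left, Set.disjoint_union_right]
  simp only [List.mem_cons, List.not_mem_nil, or_false, forall_eq_or_imp, forall_eq] at h
  obtain ⟨⟨a, b, c⟩, ⟨d, e, f⟩, g, k, l⟩ := h
  exact ⟨⟨⟨⟨a.disjoint, d.disjoint⟩, g.disjoint⟩, ⟨b.disjoint, e.disjoint⟩, k.disjoint⟩,
    ⟨c.disjoint, f.disjoint⟩, l.disjoint⟩

/-- The open segment between two points misses all edges. -/
def ChordFree (V : Fin (m + 1) → ℤ × ℤ) (a b : ℤ × ℤ) : Prop :=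
  ∀ j, ∃ f ∈ [(V j, V (j + 1)), (V (j + 1), V j), (a, b), (b, a)],
    zorient f.1 f.2 (V j) ≤ 0 ∧ zorient f.1 f.2 (V (j + 1)) ≤ 0 ∧
    0 ≤ zorient f.1 f.2 a ∧ 0 ≤ zorient f.1 f.2 b ∧
    ((zorient f.1 f.2 (V j) < 0 ∧ zorient f.1 f.2 (V (j + 1)) < 0) ∨
      0 < zorient f.1 f.2 a ∨ 0 < zorient f.1 f.2 b)

/-- The second alternative admits edges that touch the chord at an end point: a functional
nonnegative at both ends and positive at one of them is positive on the open chord. -/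
theorem notMem_boundary_of_chordFree {a b : ℤ × ℤ} (h : ChordFree V a b) {p : ℝ × ℝ}
    (hp : p ∈ openSegment ℝ (pt a) (pt b)) : p ∉ (gallery V).boundary ℝ := by
  rw [mem_boundary_iff]
  rintro ⟨j, hj⟩
  obtain ⟨f, -, h1, h2, h3, h4, h5⟩ := h j
  rcases h5 with ⟨h5, h6⟩ | h5
  · exact (orient_neg_of_mem_segment h5 h6 hj).not_ge
      (orient_nonneg_of_mem_segment h3 h4 (openSegment_subset_segment _ _ _ hp))
  · refine (orient_nonpos_of_mem_segment h1 h2 hj).not_gt ?_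
    rw [openSegment_eq_image] at hp
    obtain ⟨t, ⟨ht0, ht1⟩, rfl⟩ := hp
    have h3' : (0 : ℝ) ≤ zorient f.1 f.2 a := by exact_mod_cast h3
    have h4' : (0 : ℝ) ≤ zorient f.1 f.2 b := by exact_mod_cast h4
    simp only [← comb_eq, orient_comb, orient_pt]
    have ht1' := sub_pos.2 ht1
    rcases h5 with h5 | h5
    · have : (0 : ℝ) < zorient f.1 f.2 a := by exact_mod_cast h5
      positivity
    · have : (0 : ℝ) < zorient f.1 f.2 b := by exact_mod_cast h5
      positivity

theorem isNook_gallery (hT : Triangulation V T) {s : Fin (m + 1)} {w : ℤ × ℤ}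
    (hQ : HullFree V T [V s, V (s + 1), V (s + 1 + 1), V (s + 1 + 1 + 1)] w)
    (hc : ChordFree V (V s) (V (s + 1 + 1 + 1))) : (gallery V).IsNook s := by
  intro p hp
  simp only [finRotate_apply] at hp
  change p ∈ openSegment ℝ (pt (V s)) (pt (V (s + 1 + 1 + 1))) at hp
  exact ⟨hull_subset_closedRegion hT hQ (segment_subset_hull (by simp) (by simp)
    (openSegment_subset_segment _ _ _ hp)), notMem_boundary_of_chordFree hc hp⟩

/-! ### Looking through the mouth of a nook -/

theorem segment_subset_segment_union {t g x : ℝ × ℝ} (hx : x ∈ segment ℝ t g) :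
    segment ℝ t g ⊆ segment ℝ t x ∪ segment ℝ x g := by
  obtain ⟨r, hr0, hr1, rfl⟩ := mem_segment_iff_comb.1 hx
  intro y hy
  obtain ⟨u, hu0, hu1, rfl⟩ := mem_segment_iff_comb.1 hy
  rcases le_or_gt u r with h | h
  · left
    rcases hr0.eq_or_lt with rfl | hr
    · obtain rfl : u = 0 := le_antisymm h hu0
      rw [comb_zero]; exact left_mem_segment _ _ _
    · refine mem_segment_iff_comb.2 ⟨u / r, by positivity, by rwa [div_le_one hr], ?_⟩
      ext <;> simp only [comb] <;> field_simp <;> ring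
  · right
    have hr : 0 < 1 - r := by linarith
    refine mem_segment_iff_comb.2 ⟨(u - r) / (1 - r), div_nonneg (by linarith) hr.le, ?_, ?_⟩
    · rw [div_le_one hr]; linarith
    · ext <;> simp only [comb] <;> field_simp <;> ring

/-- The line of sight crosses the mouth `p₀ p₃` and splits there into a part in the convex set of
the guard and a part in the convex set of the nook. -/
theorem sees_through_mouth {p₀ p₃ g t : ℝ × ℝ} {S₁ S₂ : Set (ℝ × ℝ)} {P : Polygon (ℝ × ℝ) (m + 1)}
    (h₁ : S₁ ⊆ P.closedRegion) (h₂ : S₂ ⊆ P.closedRegion) (c₁ : Convex ℝ S₁) (c₂ : Convex ℝ S₂)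
    (hg : g ∈ S₁) (ht : t ∈ S₂) (m₁ : segment ℝ p₀ p₃ ⊆ S₁) (m₂ : segment ℝ p₀ p₃ ⊆ S₂)
    (e₁ : 0 < orient p₀ p₃ t) (e₂ : orient p₀ p₃ g < 0) (e₃ : orient t g p₀ ≤ 0)
    (e₄ : 0 ≤ orient t g p₃) : P.Sees g t := by
  have hD : 0 < orient p₀ p₃ t - orient p₀ p₃ g := by linarith
  have hD2 := orient_sub_orient p₀ p₃ t g
  have hx := comb_eq_comb_of_crossing (a := p₀) (b := p₃) (p := t) (q := g) hD.ne'
  have i1 : comb (-orient t g p₀ / (orient p₀ p₃ t - orient p₀ p₃ g)) p₀ p₃ ∈ segment ℝ p₀ p₃ :=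
    comb_mem_segment _ _ (div_nonneg (by linarith) hD.le) (by rw [div_le_one hD]; linarith)
  have i2 : comb (-orient t g p₀ / (orient p₀ p₃ t - orient p₀ p₃ g)) p₀ p₃ ∈ segment ℝ t g := by
    rw [← hx]
    exact comb_mem_segment _ _ (div_nonneg e₁.le hD.le) (by rw [div_le_one hD]; linarith)
  rw [sees_comm]
  refine (segment_subset_segment_union i2).trans (Set.union_subset ?_ ?_)
  · exact (c₂.segment_subset ht (m₂ i1)).trans h₂
  · exact (c₁.segment_subset (m₁ i1) hg).trans h₁

/-- The orientation is affine in each of the two moving points separately, so it suffices to check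
the four pairs of end points. -/
theorem orient_bilinear_pos {a b c d e : ℤ × ℤ} (h1 : 0 < zorient a c e) (h2 : 0 < zorient a d e)
    (h3 : 0 < zorient b c e) (h4 : 0 < zorient b d e) {t g : ℝ × ℝ}
    (ht : t ∈ segment ℝ (pt a) (pt b)) (hg : g ∈ segment ℝ (pt c) (pt d)) :
    0 < orient t g (pt e) := by
  obtain ⟨r, hr0, hr1, rfl⟩ := mem_segment_iff_comb.1 ht
  obtain ⟨s, hs0, hs1, rfl⟩ := mem_segment_iff_comb.1 hg
  have key : orient (comb r (pt a) (pt b)) (comb s (pt c) (pt d)) (pt e) =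
      (1 - r) * ((1 - s) * zorient a c e + s * zorient a d e) +
        r * ((1 - s) * zorient b c e + s * zorient b d e) := by
    simp only [← orient_pt, orient, comb]; ring
  have h1' : (0 : ℝ) < zorient a c e := by exact_mod_cast h1
  have h2' : (0 : ℝ) < zorient a d e := by exact_mod_cast h2
  have h3' : (0 : ℝ) < zorient b c e := by exact_mod_cast h3
  have h4' : (0 : ℝ) < zorient b d e := by exact_mod_cast h4
  rw [key]
  exact convexComb_pos hr0 hr1 (convexComb_pos hs0 hs1 h1' h2') (convexComb_pos hs0 hs1 h3' h4')

/-- The sign conditions under which guards on the segments `A 0 A 1` and `B 0 B 1` look through the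
mouth of the nook `s` in such a way that the former can only miss points behind the last vertex of
the nook, and the latter only points behind the first one. -/
def MouthSigns (V : Fin (m + 1) → ℤ × ℤ) (s : Fin (m + 1)) (A B : (ℤ × ℤ) × (ℤ × ℤ)) : Prop :=
  (∀ k ∈ [A.1, A.2, B.1, B.2], zorient (V (s + 1 + 1 + 1)) (V s) k < 0) ∧
  (∀ k ∈ [V (s + 1), V (s + 1 + 1)], 0 < zorient (V (s + 1 + 1 + 1)) (V s) k) ∧
  (∀ t ∈ [V (s + 1), V (s + 1 + 1)], ∀ k ∈ [A.1, A.2], 0 < zorient t k (V s)) ∧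
  (∀ t ∈ [V (s + 1), V (s + 1 + 1)], ∀ k ∈ [B.1, B.2], 0 < zorient k t (V (s + 1 + 1 + 1)))

/-- The convex regions that witness the visibility of the walls of the nook `s` from guards on the
segments `A` and `B`. -/
def NookHulls (V : Fin (m + 1) → ℤ × ℤ) (T : List (Triple (m + 1))) (s : Fin (m + 1))
    (A B : (ℤ × ℤ) × (ℤ × ℤ)) (w : Fin 5 → ℤ × ℤ) : Prop :=
  HullFree V T [V s, V (s + 1), V (s + 1 + 1), V (s + 1 + 1 + 1)] (w 0) ∧
  HullFree V T [A.1, A.2, V (s + 1 + 1 + 1), V s] (w 1) ∧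
  HullFree V T [B.1, B.2, V (s + 1 + 1 + 1), V s] (w 2) ∧
  HullFree V T [A.1, A.2, V (s + 1), V s] (w 3) ∧
  HullFree V T [B.1, B.2, V (s + 1 + 1 + 1), V (s + 1 + 1)] (w 4)

/-- Two guards see the walls of a nook if each point of the base is seen by one of them. -/
theorem guards_threeEdges (hT : Triangulation V T) {s : Fin (m + 1)} {A B : (ℤ × ℤ) × (ℤ × ℤ)}
    {w : Fin 5 → ℤ × ℤ} (hw : NookHulls V T s A B w) (hs : MouthSigns V s A B) {a b : ℝ × ℝ}
    (ha : a ∈ segment ℝ (pt A.1) (pt A.2)) (hb : b ∈ segment ℝ (pt B.1) (pt B.2))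
    (hab : ∀ t ∈ segment ℝ (pt (V (s + 1))) (pt (V (s + 1 + 1))),
      orient t a (pt (V (s + 1 + 1 + 1))) ≤ 0 ∨ 0 ≤ orient t b (pt (V s))) :
    (gallery V).Guards {a, b} ((gallery V).threeEdges s) := by
  obtain ⟨w0, w1, w2, w3, w4⟩ := hw
  obtain ⟨s1, s2, s3, s4⟩ := hs
  simp only [List.mem_cons, List.not_mem_nil, or_false, forall_eq_or_imp, forall_eq] at s1 s2 s3 s4
  obtain ⟨s11, s12, s13, s14⟩ := s1
  intro t ht
  rw [threeEdges_gallery] at ht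
  rcases ht with (ht | ht) | ht
  -- The first wall is seen entirely by `a` and the last wall entirely by `b`; only the base needs
  -- both guards.
  · exact ⟨a, by simp, sees_of_mem_hull hT w3 (segment_subset_hull (by simp) (by simp) ha)
      (segment_subset_hull (by simp) (by simp) ht)⟩
  · have ht1 := orient_pos_of_mem_segment s2.1 s2.2 ht
    -- Seeing `t` through the mouth needs one sign at each end of the mouth. For `a` the sign at the
    -- first vertex is automatic, for `b` the one at the last; `hab` supplies the remaining one.
    have htQ : t ∈ hull [V s, V (s + 1), V (s + 1 + 1), V (s + 1 + 1 + 1)] :=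
      segment_subset_hull (by simp) (by simp) ht
    rcases hab t ht with h | h
    · refine ⟨a, by simp, sees_through_mouth (hull_subset_closedRegion hT w1)
        (hull_subset_closedRegion hT w0) (convex_hull _) (convex_hull _)
        (segment_subset_hull (by simp) (by simp) ha) htQ (segment_subset_hull (by simp) (by simp))
        (segment_subset_hull (by simp) (by simp)) ht1 (orient_neg_of_mem_segment s11 s12 ha) h
        (orient_bilinear_pos s3.1.1 s3.1.2 s3.2.1 s3.2.2 ht ha).le⟩
    · refine ⟨b, by simp, sees_through_mouth (hull_subset_closedRegion hT w2)
        (hull_subset_closedRegion hT w0) (convex_hull _) (convex_hull _)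
        (segment_subset_hull (by simp) (by simp) hb) htQ (segment_subset_hull (by simp) (by simp))
        (segment_subset_hull (by simp) (by simp)) ht1 (orient_neg_of_mem_segment s13 s14 hb) ?_ h⟩
      have h4 := orient_bilinear_pos s4.1.1 s4.2.1 s4.1.2 s4.2.2 hb ht
      simp only [orient] at h4 ⊢
      linarith
  · exact ⟨b, by simp, sees_of_mem_hull hT w4 (segment_subset_hull (by simp) (by simp) hb)
      (segment_subset_hull (by simp) (by simp) ht)⟩

/-- A guard behind the line through the last wall of a nook does not see the points of the base
hidden by the last vertex of the nook. -/
theorem not_sees_behind_last {s : Fin (m + 1)} {d : ℤ × ℤ} (h : StripFree V (s + 1 + 1) d)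
    (hQ : 0 < zorient (V (s + 1)) (V (s + 1 + 1)) (V (s + 1 + 1 + 1))) {t a : ℝ × ℝ}
    {r : ℝ} (hr : r < 1) (ht : t = comb r (pt (V (s + 1))) (pt (V (s + 1 + 1))))
    (h1 : orient (pt (V (s + 1 + 1))) (pt (V (s + 1 + 1 + 1))) a < 0)
    (h2 : 0 < orient (pt (V (s + 1))) (pt (V (s + 1 + 1))) a)
    (h3 : 0 < orient t a (pt (V (s + 1 + 1 + 1)))) : ¬ (gallery V).Sees a t := by
  rw [sees_comm]
  have hQ' : 0 < orient (pt (V (s + 1))) (pt (V (s + 1 + 1))) (pt (V (s + 1 + 1 + 1))) := by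
    rw [orient_pt]; exact_mod_cast hQ
  have hr' := sub_pos.2 hr
  refine not_sees_of_crosses h ?_ h1 ?_ h3
  · have : orient (pt (V (s + 1 + 1))) (pt (V (s + 1 + 1 + 1))) t = (1 - r) *
        orient (pt (V (s + 1))) (pt (V (s + 1 + 1))) (pt (V (s + 1 + 1 + 1))) := by
      rw [ht]; simp only [orient, comb]; ring
    rw [this]; positivity
  · have : orient t a (pt (V (s + 1 + 1))) =
        -((1 - r) * orient (pt (V (s + 1))) (pt (V (s + 1 + 1))) a) := by
      rw [ht]; simp only [orient, comb]; ring
    rw [this, neg_lt_zero]; positivity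

/-- A guard behind the line through the first wall of a nook does not see the points of the base
hidden by the first vertex of the nook. -/
theorem not_sees_behind_first {s : Fin (m + 1)} {d : ℤ × ℤ} (h : StripFree V s d)
    (hQ : 0 < zorient (V s) (V (s + 1)) (V (s + 1 + 1))) {t b : ℝ × ℝ}
    {r : ℝ} (hr : 0 < r) (ht : t = comb r (pt (V (s + 1))) (pt (V (s + 1 + 1))))
    (h1 : orient (pt (V s)) (pt (V (s + 1))) b < 0)
    (h2 : 0 < orient (pt (V (s + 1))) (pt (V (s + 1 + 1))) b)
    (h3 : orient t b (pt (V s)) < 0) : ¬ (gallery V).Sees b t := by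
  rw [sees_comm]
  have hQ' : 0 < orient (pt (V s)) (pt (V (s + 1))) (pt (V (s + 1 + 1))) := by
    rw [orient_pt]; exact_mod_cast hQ
  refine not_sees_of_crosses h ?_ h1 h3 ?_
  · have : orient (pt (V s)) (pt (V (s + 1))) t = r *
        orient (pt (V s)) (pt (V (s + 1))) (pt (V (s + 1 + 1))) := by
      rw [ht]; simp only [orient, comb]; ring
    rw [this]; positivity
  · have : orient t b (pt (V (s + 1))) = r * orient (pt (V (s + 1))) (pt (V (s + 1 + 1))) b := by
      rw [ht]; simp only [orient, comb]; ring
    rw [this]; positivity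

/-- A guard in the interior of an edge does not see the points to the right of this edge. -/
theorem not_sees_right_of_edge {k : Fin (m + 1)} {d : ℤ × ℤ} (h : StripFree V k d) {t g : ℝ × ℝ}
    {r : ℝ} (hr0 : 0 < r) (hr1 : r < 1) (hg : g = comb r (pt (V k)) (pt (V (k + 1))))
    (ht : orient (pt (V k)) (pt (V (k + 1))) t < 0) : ¬ (gallery V).Sees g t := by
  have hr1' := sub_pos.2 hr1
  refine not_sees_of_crosses h ?_ ht ?_ ?_
  · rw [hg, orient_comb, orient_self_left, orient_self_right]; simp
  · have : orient g t (pt (V k)) = r * orient (pt (V k)) (pt (V (k + 1))) t := by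
      rw [hg]; simp only [orient, comb]; ring
    rw [this]; exact mul_neg_of_pos_of_neg hr0 ht
  · have : orient g t (pt (V (k + 1))) = -((1 - r) * orient (pt (V k)) (pt (V (k + 1))) t) := by
      rw [hg]; simp only [orient, comb]; ring
    rw [this, neg_pos]; exact mul_neg_of_pos_of_neg hr1' ht

end

section

variable {m : ℕ} {V : Fin (m + 1) → ℤ × ℤ}

/-! ### The boundary points visible from a point on the base of a nook -/

/-- The edge `j` meets the triangle cut out by the functionals in `hs`, which is contained in the
triangle with the vertices `vs`, at most in the points of the list `es`. -/
def Excluded (V : Fin (m + 1) → ℤ × ℤ) (es : List (ℤ × ℤ)) (hs : List ((ℤ × ℤ) × (ℤ × ℤ)))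
    (vs : List (ℤ × ℤ)) (j : Fin (m + 1)) : Prop :=
  (∃ f ∈ hs,
    (zorient f.1 f.2 (V j) < 0 ∨ zorient f.1 f.2 (V j) = 0 ∧ V j ∈ es) ∧
    (zorient f.1 f.2 (V (j + 1)) < 0 ∨
      zorient f.1 f.2 (V (j + 1)) = 0 ∧ V (j + 1) ∈ es) ∧
    zorient f.1 f.2 (V j) + zorient f.1 f.2 (V (j + 1)) < 0) ∨
  ∃ f ∈ [(V j, V (j + 1)), (V (j + 1), V j)], ∀ v ∈ vs, 0 < zorient f.1 f.2 v

/-- In the first case a functional that is nonnegative at `g` is nonpositive at both ends of the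
edge and not zero at both, so `g` is the end where it vanishes, which is listed. In the second case
the containing triangle lies strictly to one side of the edge, so `g` cannot be on the edge. -/
theorem Excluded.exists_eq {es : List (ℤ × ℤ)} {hs : List ((ℤ × ℤ) × (ℤ × ℤ))} {vs : List (ℤ × ℤ)}
    {j : Fin (m + 1)} (h : Excluded V es hs vs j) {g : ℝ × ℝ}
    (hj : g ∈ segment ℝ (pt (V j)) (pt (V (j + 1))))
    (h1 : ∀ f ∈ hs, 0 ≤ orient (pt f.1) (pt f.2) g)
    (h2 : ∀ u v, (∀ x ∈ vs, 0 < zorient u v x) → 0 < orient (pt u) (pt v) g) :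
    ∃ e ∈ es, g = pt e := by
  obtain ⟨t, ht0, ht1, rfl⟩ := mem_segment_iff_comb.1 hj
  rcases h with ⟨f, hf, hc, he, hce⟩ | ⟨f, hf, hv⟩
  · have h1 := h1 f hf
    rw [orient_comb, orient_pt, orient_pt] at h1
    have hce' : (zorient f.1 f.2 (V j) : ℝ) + zorient f.1 f.2 (V (j + 1)) < 0 := by
      exact_mod_cast hce
    have hc0 : (zorient f.1 f.2 (V j) : ℝ) ≤ 0 := by
      rcases hc with hc | hc
      · exact_mod_cast hc.le
      · exact_mod_cast hc.1.le
    have he0 : (zorient f.1 f.2 (V (j + 1)) : ℝ) ≤ 0 := by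
      rcases he with he | he
      · exact_mod_cast he.le
      · exact_mod_cast he.1.le
    have k1 := mul_nonpos_of_nonneg_of_nonpos (sub_nonneg.2 ht1) hc0
    have k2 := mul_nonpos_of_nonneg_of_nonpos ht0 he0
    have z1 : (1 - t) * (zorient f.1 f.2 (V j) : ℝ) = 0 := by linarith
    have z2 : t * (zorient f.1 f.2 (V (j + 1)) : ℝ) = 0 := by linarith
    rcases mul_eq_zero.1 z1 with y1 | y1
    · obtain rfl : t = 1 := by linarith
      rw [one_mul] at z2
      have z2' : zorient f.1 f.2 (V (j + 1)) = 0 := by exact_mod_cast z2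
      rw [comb_one]
      rcases he with he | ⟨-, he⟩
      · omega
      · exact ⟨_, he, rfl⟩
    · rcases mul_eq_zero.1 z2 with z2 | z2
      · obtain rfl : t = 0 := z2
        have z1' : zorient f.1 f.2 (V j) = 0 := by exact_mod_cast y1
        rw [comb_zero]
        rcases hc with hc | ⟨-, hc⟩
        · omega
        · exact ⟨_, hc, rfl⟩
      · linarith
  · have h2 := h2 _ _ hv
    have : orient (pt f.1) (pt f.2) (comb t (pt (V j)) (pt (V (j + 1)))) = 0 := by
      simp only [List.mem_cons, List.not_mem_nil, or_false] at hf
      rcases hf with rfl | rfl <;> simp [orient_comb, orient_self_left, orient_self_right]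
    linarith

theorem orient_pos_of_mem_tri {a b c : ℤ × ℤ} (h : 0 < orient (pt a) (pt b) (pt c)) {g : ℝ × ℝ}
    (hg : g ∈ tri (pt a) (pt b) (pt c)) (u v : ℤ × ℤ)
    (hv : ∀ x ∈ [a, b, c], 0 < zorient u v x) : 0 < orient (pt u) (pt v) g := by
  simp only [List.mem_cons, List.not_mem_nil, or_false, forall_eq_or_imp, forall_eq] at hv
  obtain ⟨ha, hb, hc⟩ := hv
  have ha' : (0 : ℝ) < zorient u v a := by exact_mod_cast ha
  have hb' : (0 : ℝ) < zorient u v b := by exact_mod_cast hb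
  have hc' : (0 : ℝ) < zorient u v c := by exact_mod_cast hc
  obtain ⟨g1, g2, g3⟩ := hg
  have e := orient_barycentric (pt a) (pt b) (pt c) g (pt u) (pt v)
  have hs := orient_sum (pt a) (pt b) (pt c) g
  simp only [orient_pt u v] at e
  have k1 := mul_nonneg g2 ha'.le
  have k2 := mul_nonneg g3 hb'.le
  have k3 := mul_nonneg g1 hc'.le
  by_contra hn
  have k := mul_nonpos_of_nonneg_of_nonpos h.le (not_lt.1 hn)
  have z1 := (mul_eq_zero.1 (show orient (pt b) (pt c) g * (zorient u v a : ℝ) = 0 by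
    linarith)).resolve_right ha'.ne'
  have z2 := (mul_eq_zero.1 (show orient (pt c) (pt a) g * (zorient u v b : ℝ) = 0 by
    linarith)).resolve_right hb'.ne'
  have z3 := (mul_eq_zero.1 (show orient (pt a) (pt b) g * (zorient u v c : ℝ) = 0 by
    linarith)).resolve_right hc'.ne'
  linarith

/-- The point `q` lies on the base of the nook `s`, and looking from `q` through the mouth of the
nook one sees only inner points of the edge `k`. -/
def SightCone (V : Fin (m + 1) → ℤ × ℤ) (s k : Fin (m + 1)) (q : ℤ × ℤ) : Prop :=
  zorient (V (s + 1)) (V (s + 1 + 1)) q = 0 ∧ 0 < zorient (V s) (V (s + 1)) q ∧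
  0 < zorient (V (s + 1 + 1)) (V (s + 1 + 1 + 1)) q ∧
  0 < zorient (V s) (V (s + 1)) (V (s + 1 + 1)) ∧
  0 < zorient (V (s + 1)) (V (s + 1 + 1)) (V (s + 1 + 1 + 1)) ∧
  0 < zorient q (V (s + 1 + 1 + 1)) (V s) ∧
  zorient q (V (s + 1 + 1 + 1)) (V k) < 0 ∧ zorient q (V s) (V k) < 0 ∧
  0 < zorient q (V (s + 1 + 1 + 1)) (V (k + 1)) ∧ 0 < zorient q (V s) (V (k + 1)) ∧
  0 < zorient (V k) (V (k + 1)) q ∧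
  ∀ j, j ≠ s → j ≠ s + 1 → j ≠ s + 1 + 1 →
    Excluded V [V (s + 1 + 1 + 1), V s] [(V (s + 1 + 1), V (s + 1 + 1 + 1)),
      (V (s + 1 + 1 + 1), q), (V (s + 1), V (s + 1 + 1))] [q, V (s + 1 + 1), V (s + 1 + 1 + 1)] j ∧
    Excluded V [V (s + 1 + 1 + 1), V s] [(V s, V (s + 1)), (q, V s), (V (s + 1), V (s + 1 + 1))]
      [q, V s, V (s + 1)] j ∧
    (j ≠ k → Excluded V [V (s + 1 + 1 + 1), V s, V k, V (k + 1)]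
      [(q, V (s + 1 + 1 + 1)), (V s, q), (V k, V (k + 1))] [q, V k, V (k + 1)] j)

/-- Free half-strips at the walls of the nook `s`, which hide the continuation of its base. -/
def NookStrips (V : Fin (m + 1) → ℤ × ℤ) (s : Fin (m + 1)) (d : Fin 3 → ℤ × ℤ) : Prop :=
  StripFree V s (d 0) ∧ StripFree V (s + 1) (d 1) ∧ StripFree V (s + 1 + 1) (d 2) ∧
  0 < zorient (V (s + 1)) (V (s + 1) + d 0) (V (s + 1 + 1)) ∧
  zorient (V (s + 1 + 1)) (V (s + 1 + 1) + d 2) (V (s + 1)) < 0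

/-- The functional `orient c a` vanishes at `a`, so its value at `p` relative to that at `b` is the
parameter of `p` on the line `a b`. -/
theorem eq_comb_of_orient_eq_zero {c a b p : ℝ × ℝ} (h : orient c a b ≠ 0)
    (hp : orient a b p = 0) : p = comb (orient c a p / orient c a b) a b := by
  have h' := h
  simp only [orient] at hp
  ext
  · simp only [comb]; field_simp; simp only [orient]; linear_combination (c.1 - a.1) * hp
  · simp only [comb]; field_simp; simp only [orient]; linear_combination (c.2 - a.2) * hp

/-- A sight line along the base that continues past one of its ends leaves through a corner of the
half-strip at the adjacent wall. The last two conditions of `NookStrips` say that it enters the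
strip there. -/
theorem mem_base_of_sees {s : Fin (m + 1)} {d : Fin 3 → ℤ × ℤ} (hd : NookStrips V s d)
    (hQ₁ : 0 < zorient (V s) (V (s + 1)) (V (s + 1 + 1)))
    (hQ₂ : 0 < zorient (V (s + 1)) (V (s + 1 + 1)) (V (s + 1 + 1 + 1))) {q g : ℝ × ℝ} {r : ℝ}
    (hr0 : 0 < r) (hr1 : r < 1) (hq : q = comb r (pt (V (s + 1))) (pt (V (s + 1 + 1))))
    (hg : orient (pt (V (s + 1))) (pt (V (s + 1 + 1))) g = 0) (hs : (gallery V).Sees q g) :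
    g ∈ segment ℝ (pt (V (s + 1))) (pt (V (s + 1 + 1))) := by
  obtain ⟨d0, -, d2, e0, e2⟩ := hd
  have hQ₁' : 0 < orient (pt (V s)) (pt (V (s + 1))) (pt (V (s + 1 + 1))) := by
    rw [orient_pt]; exact_mod_cast hQ₁
  have hQ₂' : 0 < orient (pt (V (s + 1))) (pt (V (s + 1 + 1))) (pt (V (s + 1 + 1 + 1))) := by
    rw [orient_pt]; exact_mod_cast hQ₂
  have hgu := eq_comb_of_orient_eq_zero hQ₁'.ne' hg
  set u := orient (pt (V s)) (pt (V (s + 1))) g /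
    orient (pt (V s)) (pt (V (s + 1))) (pt (V (s + 1 + 1)))
  by_contra hn
  have hu : u < 0 ∨ 1 < u := by
    by_contra hu
    push Not at hu
    exact hn (mem_segment_iff_comb.2 ⟨u, hu.1, hu.2, hgu⟩)
  rcases hu with hu | hu
  · have hd := d0.1
    refine not_sees_of_enters_strip d0 (x := pt (V (s + 1))) ?_ (orient_self_right _ _) ?_
      (Or.inl ?_) (Or.inr ⟨orient_self_left _ _, ?_⟩) hs
    · have hru : 0 < r - u := by linarith
      refine mem_segment_iff_comb.2 ⟨r / (r - u), by positivity, ?_, ?_⟩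
      · rw [div_le_one hru]; linarith
      · rw [hgu, hq]; ext <;> simp only [comb] <;> field_simp <;> ring
    · rw [hgu, orient_comb, orient_self_right]; nlinarith
    · have : zorient (V s) (V s + d 0) (V (s + 1)) = -zorient (V s) (V (s + 1)) (V s + d 0) := by
        simp only [zorient]; ring
      rw [orient_pt, this]; exact_mod_cast neg_pos.2 hd
    · have e0' : (0 : ℝ) < zorient (V (s + 1)) (V (s + 1) + d 0) (V (s + 1 + 1)) := by
        exact_mod_cast e0
      rw [hgu, orient_comb, orient_self_left, orient_pt]; nlinarith
  · have hd := d2.1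
    refine not_sees_of_enters_strip d2 (x := pt (V (s + 1 + 1))) ?_ (orient_self_left _ _) ?_
      (Or.inr ⟨orient_self_left _ _, ?_⟩) (Or.inl ?_) hs
    · have hru : 0 < u - r := by linarith
      refine mem_segment_iff_comb.2 ⟨(1 - r) / (u - r), by
        have := sub_pos.2 hr1; positivity, ?_, ?_⟩
      · rw [div_le_one hru]; linarith
      · rw [hgu, hq]; ext <;> simp only [comb] <;> field_simp <;> ring
    · rw [hgu, orient_comb, orient_self_left]
      have : orient (pt (V (s + 1 + 1))) (pt (V (s + 1 + 1 + 1))) (pt (V (s + 1))) =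
        orient (pt (V (s + 1))) (pt (V (s + 1 + 1))) (pt (V (s + 1 + 1 + 1))) :=
        (orient_rotate _ _ _).symm
      rw [this]; nlinarith
    · have e2' : (zorient (V (s + 1 + 1)) (V (s + 1 + 1) + d 2) (V (s + 1)) : ℝ) < 0 := by
        exact_mod_cast e2
      rw [hgu, orient_comb, orient_self_left, orient_pt]; nlinarith
    · have : zorient (V (s + 1 + 1 + 1)) (V (s + 1 + 1 + 1) + d 2) (V (s + 1 + 1)) =
          zorient (V (s + 1 + 1)) (V (s + 1 + 1 + 1)) (V (s + 1 + 1) + d 2) := by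
        simp only [zorient, Prod.fst_add, Prod.snd_add]; ring
      rw [orient_pt, this]; exact_mod_cast hd

theorem SightCone.exists_eq_comb {s k : Fin (m + 1)} {q : ℤ × ℤ} (hc : SightCone V s k q) :
    ∃ r, 0 < r ∧ r < 1 ∧ pt q = comb r (pt (V (s + 1))) (pt (V (s + 1 + 1))) := by
  obtain ⟨c1, c2, c3, c4, c5, -⟩ := hc
  have R : ∀ {a b c : ℤ × ℤ}, 0 < zorient a b c → 0 < orient (pt a) (pt b) (pt c) := by
    intro a b c h; rw [orient_pt]; exact_mod_cast h
  have hq0 : orient (pt (V (s + 1))) (pt (V (s + 1 + 1))) (pt q) = 0 := by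
    rw [orient_pt]; exact_mod_cast c1
  have hqr := eq_comb_of_orient_eq_zero (R c4).ne' hq0
  refine ⟨_, div_pos (R c2) (R c4), ?_, hqr⟩
  by_contra hn
  have h3 := R c3
  have h5 := R c5
  rw [hqr, orient_comb, orient_self_left] at h3
  rw [orient_rotate] at h5
  have := mul_nonpos_of_nonpos_of_nonneg (sub_nonpos.2 (not_lt.1 hn)) h5.le
  linarith

/-- The inner points of the edge `k`. -/
def innerEdge (V : Fin (m + 1) → ℤ × ℤ) (k : Fin (m + 1)) : Set (ℝ × ℝ) :=
  {g | ∃ r, 0 < r ∧ r < 1 ∧ g = comb r (pt (V k)) (pt (V (k + 1)))}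

/-- The base blocks everything beyond it. Outside the cone from `q` through the mouth, `g` is either
hidden behind a side wall or lies in a triangle between `q` and that wall, where the boundary
contributes only the rim vertices. Inside the cone, `g` is either hidden beyond the edge `k` or lies
in the triangle over this edge, where only the rim vertices and the edge itself remain. -/
theorem mem_walls_or_mem_innerEdge_of_sees {s k : Fin (m + 1)} {q : ℤ × ℤ} (hc : SightCone V s k q)
    {d : Fin 3 → ℤ × ℤ} (hd : NookStrips V s d) {e : ℤ × ℤ} (hk : StripFree V k e) {g : ℝ × ℝ}
    (hg : g ∈ (gallery V).boundary ℝ) (hs : (gallery V).Sees g (pt q)) :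
    g ∈ (gallery V).threeEdges s ∨ g ∈ innerEdge V k := by
  obtain ⟨r, hr0, hr1, hqr⟩ := hc.exists_eq_comb
  obtain ⟨c1, c2, c3, c4, c5, c6, c7, c8, c9, c10, c11, hex⟩ := hc
  rw [threeEdges_gallery]
  obtain ⟨j, hj⟩ := mem_boundary_iff.1 hg
  by_cases hj0 : j = s
  · subst hj0; exact Or.inl (Or.inl (Or.inl hj))
  by_cases hj1 : j = s + 1
  · subst hj1; exact Or.inl (Or.inl (Or.inr hj))
  by_cases hj2 : j = s + 1 + 1
  · subst hj2; exact Or.inl (Or.inr hj)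
  have hrim : (∃ e ∈ [V (s + 1 + 1 + 1), V s], g = pt e) →
      g ∈ segment ℝ (pt (V s)) (pt (V (s + 1))) ∪
        segment ℝ (pt (V (s + 1))) (pt (V (s + 1 + 1))) ∪
        segment ℝ (pt (V (s + 1 + 1))) (pt (V (s + 1 + 1 + 1))) := by
    simp only [List.mem_cons, List.not_mem_nil, or_false, exists_eq_or_imp, exists_eq_left]
    rintro (rfl | rfl)
    · exact Or.inr (right_mem_segment _ _ _)
    · exact Or.inl (Or.inl (left_mem_segment _ _ _))
  obtain ⟨x1, x3, x2⟩ := hex j hj0 hj1 hj2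
  have R : ∀ {a b c : ℤ × ℤ}, 0 < zorient a b c → 0 < orient (pt a) (pt b) (pt c) := by
    intro a b c h; rw [orient_pt]; exact_mod_cast h
  have R' : ∀ {a b c : ℤ × ℤ}, zorient a b c < 0 → orient (pt a) (pt b) (pt c) < 0 := by
    intro a b c h; rw [orient_pt]; exact_mod_cast h
  have hq0 : orient (pt (V (s + 1))) (pt (V (s + 1 + 1))) (pt q) = 0 := by
    rw [orient_pt]; exact_mod_cast c1
  have hs' := sees_comm.1 hs
  have hob : 0 ≤ orient (pt (V (s + 1))) (pt (V (s + 1 + 1))) g := by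
    by_contra hn
    exact not_sees_right_of_edge hd.2.1 hr0 hr1 hqr (not_le.1 hn) hs'
  rcases hob.eq_or_lt' with hob | hob
  · exact Or.inl (Or.inl (Or.inr (mem_base_of_sees hd c4 c5 hr0 hr1 hqr hob hs')))
  rcases lt_or_ge (orient (pt q) (pt (V (s + 1 + 1 + 1))) g) 0 with o1 | o1
  · rcases lt_or_ge (orient (pt (V (s + 1 + 1))) (pt (V (s + 1 + 1 + 1))) g) 0 with h | h
    · refine absurd hs (not_sees_behind_last hd.2.2.1 c5 hr1 hqr h hob ?_)
      simp only [orient] at o1 ⊢; linarith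
    · refine Or.inl (hrim (x1.exists_eq hj ?_ (orient_pos_of_mem_tri ?_ ⟨?_, h, ?_⟩)))
      · simp only [List.mem_cons, List.not_mem_nil, or_false, forall_eq_or_imp, forall_eq]
        exact ⟨h, by rw [orient_swap]; linarith, hob.le⟩
      · rw [orient_rotate]; exact R c3
      · have : orient (pt q) (pt (V (s + 1 + 1))) g =
            (1 - r) * orient (pt (V (s + 1))) (pt (V (s + 1 + 1))) g := by
          rw [hqr]; simp only [orient, comb]; ring
        rw [this]; exact mul_nonneg (by linarith) hob.le
      · rw [orient_swap]; linarith
  rcases lt_or_ge 0 (orient (pt q) (pt (V s)) g) with o3 | o3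
  · rcases lt_or_ge (orient (pt (V s)) (pt (V (s + 1))) g) 0 with h | h
    · refine absurd hs (not_sees_behind_first hd.1 c4 hr0 hqr h hob ?_)
      simp only [orient] at o3 ⊢; linarith
    · refine Or.inl (hrim (x3.exists_eq hj ?_ (orient_pos_of_mem_tri ?_ ⟨o3.le, h, ?_⟩)))
      · simp only [List.mem_cons, List.not_mem_nil, or_false, forall_eq_or_imp, forall_eq]
        exact ⟨h, o3.le, hob.le⟩
      · rw [orient_rotate]; exact R c2
      · have : orient (pt (V (s + 1))) (pt q) g =
            r * orient (pt (V (s + 1))) (pt (V (s + 1 + 1))) g := by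
          rw [hqr]; simp only [orient, comb]; ring
        rw [this]; exact mul_nonneg hr0.le hob.le
  have hα : 0 ≤ orient (pt q) g (pt (V s)) := by
    simp only [orient] at o3 ⊢; linarith
  -- A Plücker relation: the direction of `g` from `q` is a nonnegative combination of the
  -- directions of the two rim vertices. As `V k` and `V (k + 1)` lie on opposite sides of the cone,
  -- the ray towards `g` separates them too.
  have plucker : ∀ x, orient (pt q) (pt (V (s + 1 + 1 + 1))) (pt (V s)) * orient (pt q) g x =
      orient (pt q) g (pt (V s)) * orient (pt q) (pt (V (s + 1 + 1 + 1))) x +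
      orient (pt q) (pt (V (s + 1 + 1 + 1))) g * orient (pt q) (pt (V s)) x := by
    intro x; simp only [orient]; ring
  -- Both coefficients vanish only for `g = q`, which is impossible because `g` lies strictly to the
  -- left of the base line.
  have hne : 0 < orient (pt q) g (pt (V s)) ∨
      0 < orient (pt q) (pt (V (s + 1 + 1 + 1))) g := by
    by_contra hn
    push Not at hn
    have e : orient (pt q) (pt (V (s + 1 + 1 + 1))) (pt (V s)) *
        (orient (pt (V (s + 1))) (pt (V (s + 1 + 1))) g -
          orient (pt (V (s + 1))) (pt (V (s + 1 + 1))) (pt q)) =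
        orient (pt q) g (pt (V s)) *
          (orient (pt (V (s + 1))) (pt (V (s + 1 + 1))) (pt (V (s + 1 + 1 + 1))) -
            orient (pt (V (s + 1))) (pt (V (s + 1 + 1))) (pt q)) +
        orient (pt q) (pt (V (s + 1 + 1 + 1))) g *
          (orient (pt (V (s + 1))) (pt (V (s + 1 + 1))) (pt (V s)) -
            orient (pt (V (s + 1))) (pt (V (s + 1 + 1))) (pt q)) := by
      simp only [orient]; ring
    rw [le_antisymm hn.1 hα, le_antisymm hn.2 o1, hq0] at e
    have := mul_pos (R c6) hob
    linarith
  have c6' := R c6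
  have hlt : orient (pt q) g (pt (V k)) < 0 := by
    by_contra hn
    have p := plucker (pt (V k))
    have k0 := mul_nonneg c6'.le (not_lt.1 hn)
    have k1 := mul_nonpos_of_nonneg_of_nonpos hα (R' c7).le
    have k2 := mul_nonpos_of_nonneg_of_nonpos o1 (R' c8).le
    rcases hne with h | h
    · have := mul_neg_of_pos_of_neg h (R' c7); linarith
    · have := mul_neg_of_pos_of_neg h (R' c8); linarith
  have hgt : 0 < orient (pt q) g (pt (V (k + 1))) := by
    by_contra hn
    have p := plucker (pt (V (k + 1)))
    have k0 := mul_nonpos_of_nonneg_of_nonpos c6'.le (not_lt.1 hn)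
    have k1 := mul_nonneg hα (R c9).le
    have k2 := mul_nonneg o1 (R c10).le
    rcases hne with h | h
    · have := mul_pos h (R c9); linarith
    · have := mul_pos h (R c10); linarith
  rcases lt_or_ge (orient (pt (V k)) (pt (V (k + 1))) g) 0 with h | h
  · exact absurd hs' (not_sees_of_crosses hk (R c11).le h hlt hgt)
  have hne1 : g ≠ pt (V k) := by
    rintro rfl; exact o1.not_gt (R' c7)
  have hne2 : g ≠ pt (V (k + 1)) := by
    rintro rfl; exact o3.not_gt (R c10)
  by_cases hjk : j = k
  · subst hjk
    obtain ⟨t, ht0, ht1, rfl⟩ := mem_segment_iff_comb.1 hj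
    refine Or.inr ⟨t, ht0.lt_of_ne' ?_, ht1.lt_of_ne ?_, rfl⟩
    · rintro rfl; exact hne1 (comb_zero _ _)
    · rintro rfl; exact hne2 (comb_one _ _)
  · left
    have hx := (x2 hjk).exists_eq hj ?_ (orient_pos_of_mem_tri ?_ ⟨?_, h, ?_⟩)
    · simp only [List.mem_cons, List.not_mem_nil, or_false, exists_eq_or_imp, exists_eq_left, hne1,
        hne2] at hx
      exact hrim (by simpa using hx)
    · simp only [List.mem_cons, List.not_mem_nil, or_false, forall_eq_or_imp, forall_eq]
      exact ⟨o1, by rw [orient_swap]; linarith, h⟩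
    · rw [orient_rotate]; exact R c11
    · simp only [orient] at hlt ⊢; linarith
    · simp only [orient] at hgt ⊢; linarith

end

/-! ### Decidability of the integer sign conditions -/

section Decidable

variable {m : ℕ} (V : Fin (m + 1) → ℤ × ℤ) (T : List (Triple (m + 1)))

instance (es hs vs) (j : Fin (m + 1)) : Decidable (Excluded V es hs vs j) := by
  delta Excluded; infer_instance

instance (s k q) : Decidable (SightCone V s k q) := by
  delta SightCone; infer_instance

instance (i j) : Decidable (EdgesApart V i j) := by
  delta EdgesApart; infer_instance

instance (i d) : Decidable (StripFree V i d) := by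
  delta StripFree; infer_instance

instance (s d) : Decidable (NookStrips V s d) := by
  delta NookStrips; infer_instance

instance (ks w) : Decidable (HullFree V T ks w) := by
  delta HullFree; infer_instance

instance (a b) : Decidable (ChordFree V a b) := by
  delta ChordFree; infer_instance

instance (s A B) : Decidable (MouthSigns V s A B) := by
  delta MouthSigns; infer_instance

instance (s A B w) : Decidable (NookHulls V T s A B w) := by
  delta NookHulls; infer_instance

end Decidable

/-! ### Checks for the gallery -/

theorem edgesApart_vert :
    ∀ i j : Fin 26, i ≠ j → j ≠ i + 1 → i ≠ j + 1 → EdgesApart (m := 25) vert i j := by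
  decide +kernel

theorem isSimplePlane_vert : (gallery (m := 25) vert).IsSimplePlane :=
  isSimplePlane_gallery (by norm_num) (by decide +kernel) (by decide +kernel) edgesApart_vert

/-- The edges 0, 20 and 6 carry the guards X, Y and Z. The nook starting at 8 imposes none of the
four constraints; its test point only helps to force a guard onto edge 0. -/
theorem sightCone_vert : ∀ c ∈ ([(22, 6, (-4497, 2970)), (22, 0, (-3293, 2130)),
    (2, 20, (940, -5480)), (2, 6, (980, -3640)), (16, 20, (1894, 1540)), (8, 0, (2400, 600))] :
      List (Fin 26 × Fin 26 × (ℤ × ℤ))), SightCone (m := 25) vert c.1 c.2.1 c.2.2 := by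
  decide +kernel

theorem nookStrips_22 : NookStrips (m := 25) vert 22 ![(0, 1), (0, 1), (-4, 3)] := by
  decide +kernel

theorem nookStrips_2 : NookStrips (m := 25) vert 2 ![(-1, 0), (-1, 0), (-1, -20)] := by
  decide +kernel

theorem nookStrips_16 : NookStrips (m := 25) vert 16 ![(3, 1), (2, 1), (2, 1)] := by
  decide +kernel

theorem nookStrips_12 : NookStrips (m := 25) vert 12 ![(7, 1), (0, -1), (4, 1)] := by
  decide +kernel

theorem nookStrips_8 : NookStrips (m := 25) vert 8 ![(1, 0), (1, 0), (5, 1)] := by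
  decide +kernel

theorem stripFree_0 : StripFree (m := 25) vert 0 (0, -1) := by decide +kernel

theorem stripFree_6 : StripFree (m := 25) vert 6 (1, 0) := by decide +kernel

theorem stripFree_20 : StripFree (m := 25) vert 20 (0, 1) := by decide +kernel

/-- The end points of the range of guards of the first kind. -/
def rangeX : (ℤ × ℤ) × (ℤ × ℤ) := ((-840, 0), (-900, 0))

/-- The end points of the range of guards of the second kind. -/
def rangeY : (ℤ × ℤ) × (ℤ × ℤ) := ((1320, 1440), (1350, 1500))

/-- The end points of the range of guards of the third kind. -/
def rangeZ : (ℤ × ℤ) × (ℤ × ℤ) := ((1320, -1440), (1350, -1500))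

/-- The witnesses, here and for the other nooks, are the centroids of the four points of each hull,
rounded to integers. -/
theorem nookHulls_22 : NookHulls (m := 25) vert triangles 22 rangeX rangeZ
    ![(-3409, 2160), (-1875, 870), (-772, 135), (-1938, 945), (-1239, 480)] := by
  decide +kernel

theorem nookHulls_2 : NookHulls (m := 25) vert triangles 2 rangeZ rangeY
    ![(1010, -3902), (1198, -2345), (1198, -875), (1173, -2404), (1172, -1498)] := by
  decide +kernel

theorem nookHulls_16 : NookHulls (m := 25) vert triangles 16 rangeY rangeX
    ![(1878, 1550), (1582, 1500), (480, 765), (1588, 1492), (523, 792)] := by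
  decide +kernel

theorem nookHulls_12 : NookHulls (m := 25) vert triangles 12 rangeY rangeX
    ![(3653, 1068), (1912, 1185), (810, 450), (1904, 1075), (1982, 728)] := by
  decide +kernel

theorem mouthSigns_22 : MouthSigns (m := 25) vert 22 rangeX rangeZ := by decide +kernel

theorem mouthSigns_2 : MouthSigns (m := 25) vert 2 rangeZ rangeY := by decide +kernel

theorem mouthSigns_16 : MouthSigns (m := 25) vert 16 rangeY rangeX := by decide +kernel

theorem mouthSigns_12 : MouthSigns (m := 25) vert 12 rangeY rangeX := by decide +kernel

/-- The edges, other than the walls of the nooks, seen from the whole range `rangeX`, with points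
that witness it. -/
def seenX : List (Fin 26 × (ℤ × ℤ)) :=
  [(8, (570, 262)), (9, (765, 300)), (10, (600, 273)), (25, (-1560, 450)), (21, (-825, 720))]

/-- The edges, other than the walls of the nooks, seen from the whole range `rangeY`, with points
that witness it. -/
def seenY : List (Fin 26 × (ℤ × ℤ)) :=
  [(19, (1515, 1590)), (7, (1380, 533)), (11, (1598, 1008)), (15, (1868, 1410))]

/-- The edges, other than the walls of the nooks, seen from the whole range `rangeZ`, with points
that witness it. -/
def seenZ : List (Fin 26 × (ℤ × ℤ)) := [(5, (1335, -2070)), (1, (748, -1505))]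

theorem hullFree_seenX : ∀ c ∈ seenX, HullFree (m := 25) vert triangles
    [rangeX.1, rangeX.2, vert c.1, vert (c.1 + 1)] c.2 := by
  decide +kernel

theorem hullFree_seenY : ∀ c ∈ seenY, HullFree (m := 25) vert triangles
    [rangeY.1, rangeY.2, vert c.1, vert (c.1 + 1)] c.2 := by
  decide +kernel

theorem hullFree_seenZ : ∀ c ∈ seenZ, HullFree (m := 25) vert triangles
    [rangeZ.1, rangeZ.2, vert c.1, vert (c.1 + 1)] c.2 := by
  decide +kernel

theorem isNook_22 : (gallery (m := 25) vert).IsNook 22 :=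
  isNook_gallery triangulation nookHulls_22.1 (by decide +kernel)

theorem isNook_2 : (gallery (m := 25) vert).IsNook 2 :=
  isNook_gallery triangulation nookHulls_2.1 (by decide +kernel)

theorem isNook_16 : (gallery (m := 25) vert).IsNook 16 :=
  isNook_gallery triangulation nookHulls_16.1 (by decide +kernel)

theorem isNook_12 : (gallery (m := 25) vert).IsNook 12 :=
  isNook_gallery triangulation nookHulls_12.1 (by decide +kernel)

section

variable {m : ℕ} {V : Fin (m + 1) → ℤ × ℤ}

/-! ### The constraints imposed by the nooks -/

/-- The base point with parameter `r` is hidden from `a` by the last vertex and from `b` by the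
first. The third guard `c` misses it because the base lies to the right of the edge on which `c`
stands. -/
theorem not_guards_threeEdges {s k : Fin (m + 1)} {d : Fin 3 → ℤ × ℤ} {e p₃ p₂ p₁ p₀ : ℤ × ℤ}
    (hd : NookStrips V s d) (hk : StripFree V k e) (e₃ : V s = p₃) (e₂ : V (s + 1) = p₂)
    (e₁ : V (s + 1 + 1) = p₁) (e₀ : V (s + 1 + 1 + 1) = p₀)
    (hQ₁ : 0 < zorient p₃ p₂ p₁) (hQ₂ : 0 < zorient p₂ p₁ p₀)
    (hk₁ : zorient (V k) (V (k + 1)) p₂ < 0) (hk₂ : zorient (V k) (V (k + 1)) p₁ < 0)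
    {a b c : ℝ × ℝ} (hc : c ∈ innerEdge V k) {r : ℝ} (hr0 : 0 < r) (hr1 : r < 1)
    (a₁ : orient (pt p₁) (pt p₀) a < 0) (a₂ : 0 < orient (pt p₂) (pt p₁) a)
    (a₃ : 0 < orient (comb r (pt p₂) (pt p₁)) a (pt p₀))
    (b₁ : orient (pt p₃) (pt p₂) b < 0) (b₂ : 0 < orient (pt p₂) (pt p₁) b)
    (b₃ : orient (comb r (pt p₂) (pt p₁)) b (pt p₃) < 0) :
    ¬ (gallery V).Guards {a, b, c} ((gallery V).threeEdges s) := by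
  subst e₃ e₂ e₁ e₀
  intro h
  have ht := comb_mem_segment (pt (V (s + 1))) (pt (V (s + 1 + 1))) hr0.le hr1.le
  obtain ⟨g, hg, hs⟩ := h _ (by rw [threeEdges_gallery]; exact Or.inl (Or.inr ht))
  rcases hg with rfl | rfl | rfl
  · exact not_sees_behind_last hd.2.2.1 hQ₂ hr1 rfl a₁ a₂ a₃ hs
  · exact not_sees_behind_first hd.1 hQ₁ hr0 rfl b₁ b₂ b₃ hs
  · obtain ⟨u, hu0, hu1, rfl⟩ := hc
    exact not_sees_right_of_edge hk hu0 hu1 rfl (orient_neg_of_mem_segment hk₁ hk₂ ht) hs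

/-- If `u < w < v` and the bilinear form has a zero `r` between `0` and `1` for the value `w`, then
it separates `u` from `v`. -/
theorem exists_separating_param {α β γ δ u v w : ℝ} (hβ : 0 < β) (hδ : 0 ≤ δ) (huw : u < w)
    (hwv : w < v) (h0 : α + β * w < 0) (h1 : 0 < α + β * w + γ + δ * w) :
    ∃ r, 0 < r ∧ r < 1 ∧ α + β * u + γ * r + δ * u * r < 0 ∧
      0 < α + β * v + γ * r + δ * v * r := by
  have hc : 0 < γ + δ * w := by linarith
  have hr0 : 0 < -(α + β * w) / (γ + δ * w) := div_pos (by linarith) hc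
  -- This is the zero for the value `w`. At this `r` the form is strictly increasing in the value,
  -- since `β + δ * r > 0`.
  refine ⟨-(α + β * w) / (γ + δ * w), hr0, by rw [div_lt_one hc]; linarith, ?_⟩
  set r := -(α + β * w) / (γ + δ * w)
  have hr : r * (γ + δ * w) = -(α + β * w) := div_mul_cancel₀ _ hc.ne'
  have hk : 0 < β + δ * r := by positivity
  have k1 := mul_pos hk (sub_pos.2 huw)
  have k2 := mul_pos hk (sub_pos.2 hwv)
  constructor
  · nlinarith
  · nlinarith

theorem guardX_eq (x : ℝ) : guardX 600 x = (-600 * x, 0) := by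
  ext <;> simp [guardX]

theorem guardY_eq (y : ℝ) : guardY 600 y = (900 + 300 * y, 600 + 600 * y) := by
  ext <;> simp [guardY] <;> ring

theorem guardZ_eq (z : ℝ) : guardZ 600 z = (900 + 300 * z, -600 - 600 * z) := by
  ext <;> simp [guardZ] <;> ring

/-- The whole open edge is needed, not only `rangeX`: a priori a guard may stand anywhere on it. The
same holds for the edges 6 and 20. -/
theorem mem_innerEdge_zero {g : ℝ × ℝ} : g ∈ innerEdge (m := 25) vert 0 ↔
    ∃ x, 6 / 5 < x ∧ x < 5 / 2 ∧ g = guardX 600 x := by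
  change (∃ r : ℝ, 0 < r ∧ r < 1 ∧ g = comb r (pt (-1500, 0)) (pt (-720, 0))) ↔ _
  constructor
  · rintro ⟨r, h0, h1, rfl⟩
    refine ⟨5 / 2 - 13 / 10 * r, by linarith, by linarith, ?_⟩
    rw [guardX_eq]; ext <;> simp [comb, pt]; ring
  · rintro ⟨x, h0, h1, rfl⟩
    refine ⟨10 / 13 * (5 / 2 - x), by linarith, by linarith, ?_⟩
    rw [guardX_eq]; ext <;> simp [comb, pt]; ring

theorem mem_innerEdge_six {g : ℝ × ℝ} : g ∈ innerEdge (m := 25) vert 6 ↔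
    ∃ z, 11 / 10 < z ∧ z < 23 / 10 ∧ g = guardZ 600 z := by
  change (∃ r : ℝ, 0 < r ∧ r < 1 ∧ g = comb r (pt (1590, -1980)) (pt (1230, -1260))) ↔ _
  constructor
  · rintro ⟨r, h0, h1, rfl⟩
    refine ⟨23 / 10 - 12 / 10 * r, by linarith, by linarith, ?_⟩
    rw [guardZ_eq]; ext <;> simp [comb, pt] <;> ring
  · rintro ⟨x, h0, h1, rfl⟩
    refine ⟨10 / 12 * (23 / 10 - x), by linarith, by linarith, ?_⟩
    rw [guardZ_eq]; ext <;> simp [comb, pt] <;> ring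

theorem mem_innerEdge_twenty {g : ℝ × ℝ} : g ∈ innerEdge (m := 25) vert 20 ↔
    ∃ y, 1 < y ∧ y < 21 / 10 ∧ g = guardY 600 y := by
  change (∃ r : ℝ, 0 < r ∧ r < 1 ∧ g = comb r (pt (1530, 1860)) (pt (1200, 1200))) ↔ _
  constructor
  · rintro ⟨r, h0, h1, rfl⟩
    refine ⟨21 / 10 - 11 / 10 * r, by linarith, by linarith, ?_⟩
    rw [guardY_eq]; ext <;> simp [comb, pt] <;> ring
  · rintro ⟨x, h0, h1, rfl⟩
    refine ⟨10 / 11 * (21 / 10 - x), by linarith, by linarith, ?_⟩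
    rw [guardY_eq]; ext <;> simp [comb, pt] <;> ring

theorem guardX_mem_rangeX {x : ℝ} (h : x ∈ Set.Icc (7 / 5) (3 / 2)) :
    guardX 600 x ∈ segment ℝ (pt rangeX.1) (pt rangeX.2) := by
  refine mem_segment_iff_comb.2 ⟨10 * (x - 7 / 5), by linarith [h.1], by linarith [h.2], ?_⟩
  rw [guardX_eq]; ext <;> simp [comb, pt, rangeX]; ring

theorem guardY_mem_rangeY {y : ℝ} (h : y ∈ Set.Icc (7 / 5) (3 / 2)) :
    guardY 600 y ∈ segment ℝ (pt rangeY.1) (pt rangeY.2) := by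
  refine mem_segment_iff_comb.2 ⟨10 * (y - 7 / 5), by linarith [h.1], by linarith [h.2], ?_⟩
  rw [guardY_eq]; ext <;> simp [comb, pt, rangeY] <;> ring

theorem guardZ_mem_rangeZ {z : ℝ} (h : z ∈ Set.Icc (7 / 5) (3 / 2)) :
    guardZ 600 z ∈ segment ℝ (pt rangeZ.1) (pt rangeZ.2) := by
  refine mem_segment_iff_comb.2 ⟨10 * (z - 7 / 5), by linarith [h.1], by linarith [h.2], ?_⟩
  rw [guardZ_eq]; ext <;> simp [comb, pt, rangeZ] <;> ring

/-- If `z < x`, the two shadows on the base overlap. At the base point with parameter `r` the form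
with these coefficients is the orientation deciding whether a guard X of value `u` is hidden by the
last vertex; up to a positive factor, the same form decides whether Z is hidden by the first. A zero
for an intermediate value gives a point that both miss. -/
theorem le_of_guards_22 {x y z : ℝ} (hx : 6 / 5 < x) (hx' : x < 5 / 2) (hy : 1 < y)
    (hy' : y < 21 / 10) (hz : 11 / 10 < z)
    (h : (gallery (m := 25) vert).Guards {guardX 600 x, guardZ 600 z, guardY 600 y}
      ((gallery (m := 25) vert).threeEdges 22)) : x ≤ z := by
  by_contra! hn
  obtain ⟨w, hw1, hw2⟩ := exists_between (max_lt hn (show (23 / 20 : ℝ) < x by linarith))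
  rw [max_lt_iff] at hw1
  obtain ⟨r, hr0, hr1, hu, hv⟩ := exists_separating_param (α := -450000) (β := 180000)
    (γ := -403200) (δ := 576000) (by norm_num) (by norm_num) hw1.1 hw2 (by linarith) (by linarith)
  refine not_guards_threeEdges (p₃ := (-2760, 1680)) (p₂ := (-3250, 2100)) (p₁ := (-4626, 3060))
    (p₀ := (-3000, 1800)) nookStrips_22 stripFree_20 rfl rfl rfl rfl (by decide +kernel)
    (by decide +kernel) (by decide +kernel) (by decide +kernel)
    (mem_innerEdge_twenty.2 ⟨y, hy, hy', rfl⟩) hr0 hr1 ?_ ?_ ?_ ?_ ?_ ?_ h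
  · norm_num [orient, pt, guardX_eq]; linarith
  · norm_num [orient, pt, guardX_eq]; linarith
  · norm_num [orient, pt, comb, guardX_eq]; linarith
  · norm_num [orient, pt, guardZ_eq]; linarith
  · norm_num [orient, pt, guardZ_eq]; linarith
  · norm_num [orient, pt, comb, guardZ_eq]; linarith

theorem le_of_guards_2 {x y z : ℝ} (hx : 6 / 5 < x) (hx' : x < 5 / 2) (hy : 1 < y)
    (hy' : y < 21 / 10) (hz : 11 / 10 < z) (hz' : z < 23 / 10)
    (h : (gallery (m := 25) vert).Guards {guardZ 600 z, guardY 600 y, guardX 600 x}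
      ((gallery (m := 25) vert).threeEdges 2)) : z ≤ y := by
  by_contra! hn
  -- The bound `23 / 20` keeps the zero `r` below 1, and `w < 5 / 2` keeps it positive.
  obtain ⟨w, hw1, hw2⟩ := exists_between (max_lt hn (show (53 / 50 : ℝ) < z by linarith))
  rw [max_lt_iff] at hw1
  obtain ⟨r, hr0, hr1, hu, hv⟩ := exists_separating_param (α := -315360) (β := 129600)
    (γ := -474720) (δ := 619200) (by norm_num) (by norm_num) hw1.1 hw2 (by linarith) (by linarith)
  refine not_guards_threeEdges (p₃ := (1040, -3080)) (p₂ := (981, -3594)) (p₁ := (938, -5572))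
    (p₀ := (1080, -3360)) nookStrips_2 stripFree_0 rfl rfl rfl rfl (by decide +kernel)
    (by decide +kernel) (by decide +kernel) (by decide +kernel)
    (mem_innerEdge_zero.2 ⟨x, hx, hx', rfl⟩) hr0 hr1 ?_ ?_ ?_ ?_ ?_ ?_ h
  · norm_num [orient, pt, guardZ_eq]; linarith
  · norm_num [orient, pt, guardZ_eq]; linarith
  · norm_num [orient, pt, comb, guardZ_eq]; linarith
  · norm_num [orient, pt, guardY_eq]; linarith
  · norm_num [orient, pt, guardY_eq]; linarith
  · norm_num [orient, pt, comb, guardY_eq]; linarith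

theorem le_of_guards_16 {x y z : ℝ} (hx : 6 / 5 < x) (hx' : x < 5 / 2)
    (hy' : y < 21 / 10) (hz : 11 / 10 < z) (hz' : z < 23 / 10)
    (h : (gallery (m := 25) vert).Guards {guardY 600 y, guardX 600 x, guardZ 600 z}
      ((gallery (m := 25) vert).threeEdges 16)) : y ≤ (4 * x + 2) / (x + 4) := by
  by_contra! hn
  have hx4 : 0 < x + 4 := by linarith
  have hφ : 13 / 10 < (4 * x + 2) / (x + 4) := by rw [lt_div_iff₀ hx4]; linarith
  obtain ⟨w, hw1, hw2⟩ := exists_between hn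
  obtain ⟨r, hr0, hr1, hu, hv⟩ := exists_separating_param (α := -50880) (β := 22800)
    (γ := -7680) (δ := 28800) (by norm_num) (by norm_num) hw1 hw2 (by linarith) (by linarith)
  -- Multiplied by the denominator `x + 4`, the form at the value `(4 * x + 2) / (x + 4)` becomes a
  -- positive multiple of the orientation for the guard X.
  have hu' := mul_neg_of_neg_of_pos hu hx4
  have hm : (4 * x + 2) / (x + 4) * (x + 4) = 4 * x + 2 := div_mul_cancel₀ _ hx4.ne'
  refine not_guards_threeEdges (p₃ := (1800, 1500)) (p₂ := (1883, 1530)) (p₁ := (1971, 1610))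
    (p₀ := (1860, 1560)) nookStrips_16 stripFree_6 rfl rfl rfl rfl (by decide +kernel)
    (by decide +kernel) (by decide +kernel) (by decide +kernel)
    (mem_innerEdge_six.2 ⟨z, hz, hz', rfl⟩) hr0 hr1 ?_ ?_ ?_ ?_ ?_ ?_ h
  · norm_num [orient, pt, guardY_eq]; linarith
  · norm_num [orient, pt, guardY_eq]; linarith
  · norm_num [orient, pt, comb, guardY_eq]; linarith
  · norm_num [orient, pt, guardX_eq]; linarith
  · norm_num [orient, pt, guardX_eq]; linarith
  · norm_num [orient, pt, comb, guardX_eq]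
    linear_combination (25 / 56) * hu' + (-(22800 + 28800 * r) * (25 / 56)) * hm

theorem le_of_guards_12 {x y z : ℝ} (hx : 6 / 5 < x) (hx' : x < 5 / 2)
    (hy' : y < 21 / 10) (hz : 11 / 10 < z) (hz' : z < 23 / 10)
    (h : (gallery (m := 25) vert).Guards {guardY 600 y, guardX 600 x, guardZ 600 z}
      ((gallery (m := 25) vert).threeEdges 12)) : y ≤ (4 * x - 2) / (-x + 4) := by
  by_contra! hn
  have hx4 : 0 < -x + 4 := by linarith
  have hφ : 1 < (4 * x - 2) / (-x + 4) := by rw [lt_div_iff₀ hx4]; linarith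
  obtain ⟨w, hw1, hw2⟩ := exists_between hn
  obtain ⟨r, hr0, hr1, hu, hv⟩ := exists_separating_param (α := -902400) (β := 110400)
    (γ := -228000) (δ := 1938000) (by norm_num) (by norm_num) hw1 hw2 (by linarith) (by linarith)
  have hu' := mul_neg_of_neg_of_pos hu hx4
  have hm : (4 * x - 2) / (-x + 4) * (-x + 4) = 4 * x - 2 := div_mul_cancel₀ _ hx4.ne'
  refine not_guards_threeEdges (p₃ := (1980, 600)) (p₂ := (2964, 760)) (p₁ := (6669, 1710))
    (p₀ := (3000, 1200)) nookStrips_12 stripFree_6 rfl rfl rfl rfl (by decide +kernel)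
    (by decide +kernel) (by decide +kernel) (by decide +kernel)
    (mem_innerEdge_six.2 ⟨z, hz, hz', rfl⟩) hr0 hr1 ?_ ?_ ?_ ?_ ?_ ?_ h
  · norm_num [orient, pt, guardY_eq]; linarith
  · norm_num [orient, pt, guardY_eq]; linarith
  · norm_num [orient, pt, comb, guardY_eq]; linarith
  · norm_num [orient, pt, guardX_eq]; linarith
  · norm_num [orient, pt, guardX_eq]; linarith
  · norm_num [orient, pt, comb, guardX_eq]
    linear_combination (1 / 14) * hu' + (-(110400 + 1938000 * r) * (1 / 14)) * hm

end

/-! ### Positions that satisfy the constraints -/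

/-- The conditions for X and Z are the same form up to a positive factor, and it increases with the
value; `k` is the part of the increment that is bilinear in value and base parameter. -/
theorem covers_base_22 {x z : ℝ} (hxz : x ≤ z) {t : ℝ × ℝ}
    (ht : t ∈ segment ℝ (pt (-3250, 2100)) (pt (-4626, 3060))) :
    orient t (guardX 600 x) (pt (-3000, 1800)) ≤ 0 ∨
      0 ≤ orient t (guardZ 600 z) (pt (-2760, 1680)) := by
  obtain ⟨r, h0, h1, rfl⟩ := mem_segment_iff_comb.1 ht
  have k := mul_nonneg (sub_nonneg.2 hxz) h0
  rw [or_iff_not_imp_left, not_le]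
  norm_num [orient, pt, comb, guardX_eq, guardZ_eq]
  intro h; linarith

theorem covers_base_2 {y z : ℝ} (hzy : z ≤ y) {t : ℝ × ℝ}
    (ht : t ∈ segment ℝ (pt (981, -3594)) (pt (938, -5572))) :
    orient t (guardZ 600 z) (pt (1080, -3360)) ≤ 0 ∨
      0 ≤ orient t (guardY 600 y) (pt (1040, -3080)) := by
  obtain ⟨r, h0, h1, rfl⟩ := mem_segment_iff_comb.1 ht
  have k := mul_nonneg (sub_nonneg.2 hzy) h0
  rw [or_iff_not_imp_left, not_le]
  norm_num [orient, pt, comb, guardY_eq, guardZ_eq]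
  intro h; linarith

theorem covers_base_16 {x y : ℝ} (hx : 0 < x + 4) (h : y ≤ (4 * x + 2) / (x + 4)) {t : ℝ × ℝ}
    (ht : t ∈ segment ℝ (pt (1883, 1530)) (pt (1971, 1610))) :
    orient t (guardY 600 y) (pt (1860, 1560)) ≤ 0 ∨
      0 ≤ orient t (guardX 600 x) (pt (1800, 1500)) := by
  obtain ⟨r, h0, h1, rfl⟩ := mem_segment_iff_comb.1 ht
  rw [le_div_iff₀ hx] at h
  have k := mul_nonneg (sub_nonneg.2 h) h0
  rw [or_iff_not_imp_left, not_le]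
  norm_num [orient, pt, comb, guardY_eq, guardX_eq]
  intro h'
  have := mul_pos (sub_pos.2 h') hx
  linarith

theorem covers_base_12 {x y : ℝ} (hx : 0 < -x + 4) (h : y ≤ (4 * x - 2) / (-x + 4)) {t : ℝ × ℝ}
    (ht : t ∈ segment ℝ (pt (2964, 760)) (pt (6669, 1710))) :
    orient t (guardY 600 y) (pt (3000, 1200)) ≤ 0 ∨
      0 ≤ orient t (guardX 600 x) (pt (1980, 600)) := by
  obtain ⟨r, h0, h1, rfl⟩ := mem_segment_iff_comb.1 ht
  rw [le_div_iff₀ hx] at h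
  have k := mul_nonneg (sub_nonneg.2 h) h0
  rw [or_iff_not_imp_left, not_le]
  norm_num [orient, pt, comb, guardY_eq, guardX_eq]
  intro h'
  have := mul_pos (sub_pos.2 h') hx
  linarith

theorem guards_mono {n : ℕ} {P : Polygon (ℝ × ℝ) n} {G G' T T' : Set (ℝ × ℝ)} (h : P.Guards G T)
    (hG : G ⊆ G') (hT : T' ⊆ T) : P.Guards G' T' := fun t ht =>
  let ⟨g, hg, hs⟩ := h t (hT ht)
  ⟨g, hG hg, hs⟩

/-- Two guards seeing the walls implies three guards seeing them, so a lower bound with two and a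
necessity with three settle both equivalences. -/
theorem nookImposes_of {n : ℕ} {P : Polygon (ℝ × ℝ) n} {s : Fin n} {a b c : ℝ × ℝ} {C : Prop}
    (h₁ : C → P.Guards {a, b} (P.threeEdges s)) (h₂ : P.Guards {a, b, c} (P.threeEdges s) → C) :
    P.NookImposes s a b c C := by
  have hsub : ({a, b} : Set (ℝ × ℝ)) ⊆ {a, b, c} := by
    intro g hg; simp only [Set.mem_insert_iff, Set.mem_singleton_iff] at hg ⊢; tauto
  exact ⟨⟨fun h => h₂ (guards_mono h hsub subset_rfl), h₁⟩,
    ⟨h₂, fun h => guards_mono (h₁ h) hsub subset_rfl⟩⟩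

section Ranges

variable {x y z : ℝ}

theorem guards_22 (hx : x ∈ Set.Icc (7 / 5 : ℝ) (3 / 2)) (hz : z ∈ Set.Icc (7 / 5 : ℝ) (3 / 2))
    (h : x ≤ z) : (gallery (m := 25) vert).Guards {guardX 600 x, guardZ 600 z}
      ((gallery (m := 25) vert).threeEdges 22) :=
  guards_threeEdges triangulation nookHulls_22 mouthSigns_22 (guardX_mem_rangeX hx)
    (guardZ_mem_rangeZ hz) fun _ ht => covers_base_22 h ht

theorem guards_2 (hy : y ∈ Set.Icc (7 / 5 : ℝ) (3 / 2)) (hz : z ∈ Set.Icc (7 / 5 : ℝ) (3 / 2))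
    (h : z ≤ y) : (gallery (m := 25) vert).Guards {guardZ 600 z, guardY 600 y}
      ((gallery (m := 25) vert).threeEdges 2) :=
  guards_threeEdges triangulation nookHulls_2 mouthSigns_2 (guardZ_mem_rangeZ hz)
    (guardY_mem_rangeY hy) fun _ ht => covers_base_2 h ht

theorem guards_16 (hx : x ∈ Set.Icc (7 / 5 : ℝ) (3 / 2)) (hy : y ∈ Set.Icc (7 / 5 : ℝ) (3 / 2))
    (h : y ≤ (4 * x + 2) / (x + 4)) :
    (gallery (m := 25) vert).Guards {guardY 600 y, guardX 600 x}
      ((gallery (m := 25) vert).threeEdges 16) :=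
  guards_threeEdges triangulation nookHulls_16 mouthSigns_16 (guardY_mem_rangeY hy)
    (guardX_mem_rangeX hx) fun _ ht => covers_base_16 (by linarith [hx.1]) h ht

theorem guards_12 (hx : x ∈ Set.Icc (7 / 5 : ℝ) (3 / 2)) (hy : y ∈ Set.Icc (7 / 5 : ℝ) (3 / 2))
    (h : y ≤ (4 * x - 2) / (-x + 4)) :
    (gallery (m := 25) vert).Guards {guardY 600 y, guardX 600 x}
      ((gallery (m := 25) vert).threeEdges 12) :=
  guards_threeEdges triangulation nookHulls_12 mouthSigns_12 (guardY_mem_rangeY hy)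
    (guardX_mem_rangeX hx) fun _ ht => covers_base_12 (by linarith [hx.2]) h ht

end Ranges

/-- The nooks of the gallery in the order of the constraints. -/
def nooks : Fin 4 → Fin 26 := ![22, 2, 16, 12]

theorem nookImposes_vert {x y z : ℝ} (hx : x ∈ Set.Icc (7 / 5 : ℝ) (3 / 2))
    (hy : y ∈ Set.Icc (7 / 5 : ℝ) (3 / 2)) (hz : z ∈ Set.Icc (7 / 5 : ℝ) (3 / 2)) :
    (gallery (m := 25) vert).NookImposes 22 (guardX 600 x) (guardZ 600 z) (guardY 600 y) (z ≥ x) ∧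
    (gallery (m := 25) vert).NookImposes 2 (guardY 600 y) (guardZ 600 z) (guardX 600 x) (y ≥ z) ∧
    (gallery (m := 25) vert).NookImposes 16 (guardX 600 x) (guardY 600 y) (guardZ 600 z)
      ((4 * x + 2) / (x + 4) ≥ y) ∧
    (gallery (m := 25) vert).NookImposes 12 (guardX 600 x) (guardY 600 y) (guardZ 600 z)
      ((4 * x - 2) / (-x + 4) ≥ y) := by
  have x1 := hx.1
  have x2 := hx.2
  have y1 := hy.1
  have y2 := hy.2
  have z1 := hz.1
  have z2 := hz.2
  refine ⟨nookImposes_of (guards_22 hx hz) fun h => ?_, nookImposes_of (fun h => ?_) fun h => ?_,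
    nookImposes_of (fun h => ?_) fun h => ?_, nookImposes_of (fun h => ?_) fun h => ?_⟩
  · exact le_of_guards_22 (by linarith) (by linarith) (by linarith) (by linarith) (by linarith) h
  · rw [Set.pair_comm]; exact guards_2 hy hz h
  · rw [Set.insert_comm] at h
    exact le_of_guards_2 (by linarith) (by linarith) (by linarith) (by linarith) (by linarith)
      (by linarith) h
  · rw [Set.pair_comm]; exact guards_16 hx hy h
  · rw [Set.insert_comm] at h
    exact le_of_guards_16 (by linarith) (by linarith) (by linarith) (by linarith) (by linarith) h
  · rw [Set.pair_comm]; exact guards_12 hx hy h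
  · rw [Set.insert_comm] at h
    exact le_of_guards_12 (by linarith) (by linarith) (by linarith) (by linarith) (by linarith) h

theorem innerEdge_subset_edge {m : ℕ} {V : Fin (m + 1) → ℤ × ℤ} {k : Fin (m + 1)} :
    innerEdge V k ⊆ segment ℝ (pt (V k)) (pt (V (k + 1))) := by
  rintro _ ⟨r, h0, h1, rfl⟩
  exact comb_mem_segment _ _ h0.le h1.le

theorem sees_of_mem_edge {m : ℕ} {V : Fin (m + 1) → ℤ × ℤ} {k : Fin (m + 1)} {p q : ℝ × ℝ}
    (hp : p ∈ segment ℝ (pt (V k)) (pt (V (k + 1))))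
    (hq : q ∈ segment ℝ (pt (V k)) (pt (V (k + 1)))) : (gallery V).Sees p q := fun _ hr =>
  Or.inl (mem_boundary_iff.2 ⟨k, (convex_segment _ _).segment_subset hp hq hr⟩)

theorem edge_subset_threeEdges {m : ℕ} {V : Fin (m + 1) → ℤ × ℤ} {s j : Fin (m + 1)}
    (h : j ∈ [s, s + 1, s + 1 + 1]) :
    segment ℝ (pt (V j)) (pt (V (j + 1))) ⊆ (gallery V).threeEdges s := by
  rw [threeEdges_gallery]
  simp only [List.mem_cons, List.not_mem_nil, or_false] at h
  rcases h with rfl | rfl | rfl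
  · exact fun _ h => Or.inl (Or.inl h)
  · exact fun _ h => Or.inl (Or.inr h)
  · exact fun _ h => Or.inr h

theorem threeEdges_subset_boundary {n : ℕ} (P : Polygon (ℝ × ℝ) n) (s : Fin n) :
    P.threeEdges s ⊆ P.boundary ℝ := by
  unfold Polygon.threeEdges Polygon.boundary
  exact Set.union_subset (Set.union_subset (Set.subset_iUnion _ _) (Set.subset_iUnion _ _))
    (Set.subset_iUnion _ _)

theorem guardX_mem_innerEdge {x : ℝ} (hx : x ∈ Set.Icc (7 / 5 : ℝ) (3 / 2)) :
    guardX 600 x ∈ innerEdge (m := 25) vert 0 :=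
  mem_innerEdge_zero.2 ⟨x, by linarith [hx.1], by linarith [hx.2], rfl⟩

theorem guardY_mem_innerEdge {y : ℝ} (hy : y ∈ Set.Icc (7 / 5 : ℝ) (3 / 2)) :
    guardY 600 y ∈ innerEdge (m := 25) vert 20 :=
  mem_innerEdge_twenty.2 ⟨y, by linarith [hy.1], by linarith [hy.2], rfl⟩

theorem guardZ_mem_innerEdge {z : ℝ} (hz : z ∈ Set.Icc (7 / 5 : ℝ) (3 / 2)) :
    guardZ 600 z ∈ innerEdge (m := 25) vert 6 :=
  mem_innerEdge_six.2 ⟨z, by linarith [hz.1], by linarith [hz.2], rfl⟩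

theorem innerEdge_subset_boundary {m : ℕ} {V : Fin (m + 1) → ℤ × ℤ} {k : Fin (m + 1)} :
    innerEdge V k ⊆ (gallery V).boundary ℝ := fun _ h =>
  mem_boundary_iff.2 ⟨k, innerEdge_subset_edge h⟩

theorem edge_cases : ∀ j : Fin 26, j ∈ [(22 : Fin 26), 22 + 1, 22 + 1 + 1] ∨
    j ∈ [(2 : Fin 26), 2 + 1, 2 + 1 + 1] ∨ j ∈ [(16 : Fin 26), 16 + 1, 16 + 1 + 1] ∨
    j ∈ [(12 : Fin 26), 12 + 1, 12 + 1 + 1] ∨ j ∈ seenX.map Prod.fst ∨ j ∈ seenY.map Prod.fst ∨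
    j ∈ seenZ.map Prod.fst ∨ j = 0 ∨ j = 20 ∨ j = 6 := by
  decide +kernel

theorem isBoundaryGuarding_of_constraints {x y z : ℝ} (hx : x ∈ Set.Icc (7 / 5 : ℝ) (3 / 2))
    (hy : y ∈ Set.Icc (7 / 5 : ℝ) (3 / 2)) (hz : z ∈ Set.Icc (7 / 5 : ℝ) (3 / 2))
    (h : NookConstraints x y z) :
    (gallery (m := 25) vert).IsBoundaryGuarding {guardX 600 x, guardY 600 y, guardZ 600 z} := by
  obtain ⟨h1, h2, h3, h4⟩ := h
  constructor
  · rintro g (rfl | rfl | rfl)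
    · exact innerEdge_subset_boundary (guardX_mem_innerEdge hx)
    · exact innerEdge_subset_boundary (guardY_mem_innerEdge hy)
    · exact innerEdge_subset_boundary (guardZ_mem_innerEdge hz)
  · intro t ht
    obtain ⟨j, hj⟩ := mem_boundary_iff.1 ht
    rcases edge_cases j with h | h | h | h | h | h | h | h | h | h
    · exact guards_mono (guards_22 hx hz h1) (by intro g hg; simp at hg ⊢; tauto)
        (edge_subset_threeEdges h) t hj
    · exact guards_mono (guards_2 hy hz h2) (by intro g hg; simp at hg ⊢; tauto)
        (edge_subset_threeEdges h) t hj
    · exact guards_mono (guards_16 hx hy h3) (by intro g hg; simp at hg ⊢; tauto)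
        (edge_subset_threeEdges h) t hj
    · exact guards_mono (guards_12 hx hy h4) (by intro g hg; simp at hg ⊢; tauto)
        (edge_subset_threeEdges h) t hj
    · obtain ⟨c, hc, rfl⟩ := List.mem_map.1 h
      exact ⟨guardX 600 x, by simp, sees_of_mem_hull triangulation (hullFree_seenX c hc)
        (segment_subset_hull (by simp) (by simp) (guardX_mem_rangeX hx))
        (segment_subset_hull (by simp) (by simp) hj)⟩
    · obtain ⟨c, hc, rfl⟩ := List.mem_map.1 h
      exact ⟨guardY 600 y, by simp, sees_of_mem_hull triangulation (hullFree_seenY c hc)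
        (segment_subset_hull (by simp) (by simp) (guardY_mem_rangeY hy))
        (segment_subset_hull (by simp) (by simp) hj)⟩
    · obtain ⟨c, hc, rfl⟩ := List.mem_map.1 h
      exact ⟨guardZ 600 z, by simp, sees_of_mem_hull triangulation (hullFree_seenZ c hc)
        (segment_subset_hull (by simp) (by simp) (guardZ_mem_rangeZ hz))
        (segment_subset_hull (by simp) (by simp) hj)⟩
    · subst h
      exact ⟨guardX 600 x, by simp,
        sees_of_mem_edge (innerEdge_subset_edge (guardX_mem_innerEdge hx)) hj⟩
    · subst h
      exact ⟨guardY 600 y, by simp,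
        sees_of_mem_edge (innerEdge_subset_edge (guardY_mem_innerEdge hy)) hj⟩
    · subst h
      exact ⟨guardZ 600 z, by simp,
        sees_of_mem_edge (innerEdge_subset_edge (guardZ_mem_innerEdge hz)) hj⟩

/-! ### At most three guards -/

/-- Groups of edges such that three guards must be distributed over the last three groups. -/
def zoneEdges : Fin 7 → List (Fin 26) :=
  ![[22, 22 + 1, 22 + 1 + 1], [2, 2 + 1, 2 + 1 + 1], [16, 16 + 1, 16 + 1 + 1],
    [8, 8 + 1, 8 + 1 + 1], [0], [20], [6]]

/-- The union of the edges in a group. -/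
def zone (k : Fin 7) : Set (ℝ × ℝ) :=
  {g | ∃ i ∈ zoneEdges k, g ∈ segment ℝ (pt (vert i)) (pt (vert (i + 1)))}

theorem edgesApart_zones : ∀ k l, k ≠ l → ∀ i ∈ zoneEdges k, ∀ j ∈ zoneEdges l,
    EdgesApart (m := 25) vert i j := by
  decide +kernel

theorem eq_of_mem_zone {k l : Fin 7} {g : ℝ × ℝ} (hk : g ∈ zone k) (hl : g ∈ zone l) : k = l := by
  by_contra hne
  obtain ⟨i, hi, hgi⟩ := hk
  obtain ⟨j, hj, hgj⟩ := hl
  exact Set.disjoint_left.1 (edgesApart_zones k l hne i hi j hj).disjoint hgi hgj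

theorem threeEdges_subset_zone {s : Fin 26} {k : Fin 7} (h : zoneEdges k = [s, s + 1, s + 1 + 1]) :
    (gallery (m := 25) vert).threeEdges s ⊆ zone k := by
  intro g hg
  rw [threeEdges_gallery] at hg
  rcases hg with (hg | hg) | hg
  · exact ⟨s, by simp [h], hg⟩
  · exact ⟨s + 1, by simp [h], hg⟩
  · exact ⟨s + 1 + 1, by simp [h], hg⟩

theorem innerEdge_subset_zone {s : Fin 26} {k : Fin 7} (h : zoneEdges k = [s]) :
    innerEdge (m := 25) vert s ⊆ zone k := fun _ hg =>
  ⟨s, by simp [h], innerEdge_subset_edge hg⟩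

/-- A set containing 0 must also meet the disjoint pairs `{1, 6}`, `{2, 5}`, `{3, 4}`; one
containing 1 must also meet `{0, 6}`, `{2, 5}`, `{3, 4}`. Either way it has four elements. -/
theorem three_zones (H : Finset (Fin 7)) (hH : H.card ≤ 3) (h₁ : 0 ∈ H ∨ 6 ∈ H)
    (h₂ : 0 ∈ H ∨ 4 ∈ H) (h₃ : 1 ∈ H ∨ 5 ∈ H) (h₄ : 1 ∈ H ∨ 6 ∈ H) (h₅ : 2 ∈ H ∨ 5 ∈ H)
    (h₆ : 3 ∈ H ∨ 4 ∈ H) : 0 ∉ H ∧ 1 ∉ H := by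
  have key : ∀ H : Finset (Fin 7), H.card ≤ 3 ∧ (0 ∈ H ∨ 6 ∈ H) ∧ (0 ∈ H ∨ 4 ∈ H) ∧
      (1 ∈ H ∨ 5 ∈ H) ∧ (1 ∈ H ∨ 6 ∈ H) ∧ (2 ∈ H ∨ 5 ∈ H) ∧ (3 ∈ H ∨ 4 ∈ H) → 0 ∉ H ∧ 1 ∉ H := by
    decide +kernel
  exact key H ⟨hH, h₁, h₂, h₃, h₄, h₅, h₆⟩

/-- The zones are pairwise disjoint, so choosing a guard in each occupied zone is injective. -/
theorem card_zones_le {G : Set (ℝ × ℝ)} (hG : G.encard ≤ 3) (H : Finset (Fin 7))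
    (hH : ∀ k ∈ H, ∃ g ∈ G, g ∈ zone k) : H.card ≤ 3 := by
  choose! f hf using hH
  have : (H : Set (Fin 7)).encard ≤ G.encard :=
    Set.encard_le_encard_of_injOn (f := f) (fun k hk => (hf k hk).1) fun k hk l hl hkl =>
      eq_of_mem_zone (hf k hk).2 (hkl ▸ (hf l hl).2)
  rw [Set.encard_coe_eq_coe_finsetCard] at this
  exact_mod_cast this.trans hG

theorem exists_mem_of_sightCone {m : ℕ} {V : Fin (m + 1) → ℤ × ℤ} {s k : Fin (m + 1)} {q : ℤ × ℤ}
    (hc : SightCone V s k q) {d : Fin 3 → ℤ × ℤ} (hd : NookStrips V s d) {e : ℤ × ℤ}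
    (hk : StripFree V k e) {G : Set (ℝ × ℝ)} (hG : (gallery V).IsBoundaryGuarding G) :
    (∃ g ∈ G, g ∈ (gallery V).threeEdges s) ∨ ∃ g ∈ G, g ∈ innerEdge V k := by
  obtain ⟨r, hr0, hr1, hq⟩ := hc.exists_eq_comb
  obtain ⟨g, hg, hs⟩ := hG.2 (pt q) (mem_boundary_iff.2
    ⟨s + 1, hq ▸ comb_mem_segment _ _ hr0.le hr1.le⟩)
  rcases mem_walls_or_mem_innerEdge_of_sees hc hd hk (hG.1 hg) hs with h | h
  · exact Or.inl ⟨g, hg, h⟩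
  · exact Or.inr ⟨g, hg, h⟩

/-- Each test point demands a guard in its nook or on one edge. Since `three_zones` rules out guards
on the walls of the nooks 22 and 2, their test points force a guard on each of the edges 0, 20 and
6. -/
theorem exists_positions_of_isBoundaryGuarding {G : Set (ℝ × ℝ)} (hcard : G.encard ≤ 3)
    (hG : (gallery (m := 25) vert).IsBoundaryGuarding G) :
    ∃ x y z : ℝ, (6 / 5 < x ∧ x < 5 / 2) ∧ (1 < y ∧ y < 21 / 10) ∧ (11 / 10 < z ∧ z < 23 / 10) ∧
      G = {guardX 600 x, guardY 600 y, guardZ 600 z} := by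
  classical
  have f₁ := exists_mem_of_sightCone (sightCone_vert (22, 6, (-4497, 2970)) (by simp))
    nookStrips_22 stripFree_6 hG
  have f₂ := exists_mem_of_sightCone (sightCone_vert (22, 0, (-3293, 2130)) (by simp))
    nookStrips_22 stripFree_0 hG
  have f₃ := exists_mem_of_sightCone (sightCone_vert (2, 20, (940, -5480)) (by simp))
    nookStrips_2 stripFree_20 hG
  have f₄ := exists_mem_of_sightCone (sightCone_vert (2, 6, (980, -3640)) (by simp))
    nookStrips_2 stripFree_6 hG
  have f₅ := exists_mem_of_sightCone (sightCone_vert (16, 20, (1894, 1540)) (by simp))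
    nookStrips_16 stripFree_20 hG
  have f₆ := exists_mem_of_sightCone (sightCone_vert (8, 0, (2400, 600)) (by simp))
    nookStrips_8 stripFree_0 hG
  let H : Finset (Fin 7) := {k | ∃ g ∈ G, g ∈ zone k}
  have hH : ∀ k, k ∈ H ↔ ∃ g ∈ G, g ∈ zone k := fun k => by simp [H]
  have hW : ∀ {s : Fin 26} (k : Fin 7), zoneEdges k = [s, s + 1, s + 1 + 1] →
      (∃ g ∈ G, g ∈ (gallery (m := 25) vert).threeEdges s) → k ∈ H := by
    rintro s k h ⟨g, hg, hs⟩
    exact (hH k).2 ⟨g, hg, threeEdges_subset_zone h hs⟩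
  have hE : ∀ {s : Fin 26} (k : Fin 7), zoneEdges k = [s] →
      (∃ g ∈ G, g ∈ innerEdge (m := 25) vert s) → k ∈ H := by
    rintro s k h ⟨g, hg, hs⟩
    exact (hH k).2 ⟨g, hg, innerEdge_subset_zone h hs⟩
  obtain ⟨h0, h1⟩ := three_zones H (card_zones_le hcard H fun k hk => (hH k).1 hk)
    (f₁.imp (hW 0 rfl) (hE 6 rfl)) (f₂.imp (hW 0 rfl) (hE 4 rfl)) (f₃.imp (hW 1 rfl) (hE 5 rfl))
    (f₄.imp (hW 1 rfl) (hE 6 rfl)) (f₅.imp (hW 2 rfl) (hE 5 rfl)) (f₆.imp (hW 3 rfl) (hE 4 rfl))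
  obtain ⟨gx, hgx, hx⟩ := f₂.resolve_left fun h => h0 (hW 0 rfl h)
  obtain ⟨gy, hgy, hy⟩ := f₃.resolve_left fun h => h1 (hW 1 rfl h)
  obtain ⟨gz, hgz, hz⟩ := f₁.resolve_left fun h => h0 (hW 0 rfl h)
  have hxz := innerEdge_subset_zone (k := 4) rfl hx
  have hyz := innerEdge_subset_zone (k := 5) rfl hy
  have hzz := innerEdge_subset_zone (k := 6) rfl hz
  have nxy : gx ≠ gy := by
    rintro rfl; exact absurd (eq_of_mem_zone hxz hyz) (by decide)
  have nxz : gx ≠ gz := by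
    rintro rfl; exact absurd (eq_of_mem_zone hxz hzz) (by decide)
  have nyz : gy ≠ gz := by
    rintro rfl; exact absurd (eq_of_mem_zone hyz hzz) (by decide)
  obtain ⟨x, hx0, hx1, rfl⟩ := mem_innerEdge_zero.1 hx
  obtain ⟨y, hy0, hy1, rfl⟩ := mem_innerEdge_twenty.1 hy
  obtain ⟨z, hz0, hz1, rfl⟩ := mem_innerEdge_six.1 hz
  refine ⟨x, y, z, ⟨hx0, hx1⟩, ⟨hy0, hy1⟩, ⟨hz0, hz1⟩, ?_⟩
  -- Three distinct guards have been found in `G`, so the bound on its size leaves no others.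
  have hfin : G.Finite := Set.finite_of_encard_le_coe (k := 3) hcard
  refine (hfin.eq_of_subset_of_encard_le' ?_ ?_).symm
  · rintro g (rfl | rfl | rfl) <;> assumption
  · rw [Set.encard_eq_three.2 ⟨_, _, _, nxy, nxz, nyz, rfl⟩]; exact hcard

theorem nookConstraints_of_isBoundaryGuarding {x y z : ℝ} (hx : 6 / 5 < x ∧ x < 5 / 2)
    (hy : 1 < y ∧ y < 21 / 10) (hz : 11 / 10 < z ∧ z < 23 / 10)
    (h : (gallery (m := 25) vert).IsBoundaryGuarding {guardX 600 x, guardY 600 y, guardZ 600 z}) :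
    NookConstraints x y z := by
  have hg : ∀ s, (gallery (m := 25) vert).Guards {guardX 600 x, guardY 600 y, guardZ 600 z}
      ((gallery (m := 25) vert).threeEdges s) := fun s =>
    guards_mono h.2 subset_rfl (threeEdges_subset_boundary _ s)
  refine ⟨le_of_guards_22 hx.1 hx.2 hy.1 hy.2 hz.1 ?_,
    le_of_guards_2 hx.1 hx.2 hy.1 hy.2 hz.1 hz.2 ?_, le_of_guards_16 hx.1 hx.2 hy.2 hz.1 hz.2 ?_,
    le_of_guards_12 hx.1 hx.2 hy.2 hz.1 hz.2 ?_⟩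
  · exact guards_mono (hg 22) (by intro g hg; simp at hg ⊢; tauto) subset_rfl
  · exact guards_mono (hg 2) (by intro g hg; simp at hg ⊢; tauto) subset_rfl
  · exact guards_mono (hg 16) (by intro g hg; simp at hg ⊢; tauto) subset_rfl
  · exact guards_mono (hg 12) (by intro g hg; simp at hg ⊢; tauto) subset_rfl

theorem edgesApart_nooks : ∀ k l, k ≠ l → ∀ i ∈ [nooks k, nooks k + 1, nooks k + 1 + 1],
    ∀ j ∈ [nooks l, nooks l + 1, nooks l + 1 + 1], EdgesApart (m := 25) vert i j := by
  decide +kernel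

/-! ### The constraints -/

theorem nookConstraints_iff {x y z : ℝ} (h₁ : -4 < x) (h₂ : x < 4) : NookConstraints x y z ↔
    (x = √2 ∧ y = √2 ∧ z = √2) ∨ (x = -√2 ∧ y = -√2 ∧ z = -√2) := by
  have hs : √2 ^ 2 = 2 := Real.sq_sqrt (by norm_num)
  have h0 : 0 ≤ √2 := Real.sqrt_nonneg 2
  have p₁ : 0 < x + 4 := by linarith
  have p₂ : 0 < -x + 4 := by linarith
  unfold NookConstraints
  simp only [ge_iff_le, le_div_iff₀ p₁, le_div_iff₀ p₂]
  constructor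
  · rintro ⟨a, b, c, d⟩
    have e₁ := mul_le_mul_of_nonneg_right (a.trans b) p₁.le
    have e₂ := mul_le_mul_of_nonneg_right (a.trans b) p₂.le
    -- With `x ≤ y`, constraint `c` gives `x * (x + 4) ≤ 4 * x + 2` and `d` gives `x * (4 - x) ≤ 4 *
    -- x - 2`.
    have hx : x ^ 2 = 2 := by nlinarith
    have hyx : y = x := by
      refine le_antisymm ?_ (a.trans b)
      by_contra hn
      have := mul_lt_mul_of_pos_right (not_le.1 hn) p₁
      nlinarith
    have hzx : z = x := le_antisymm (hyx ▸ b) a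
    have : (x - √2) * (x + √2) = 0 := by ring_nf; rw [hs, hx]; ring
    rcases mul_eq_zero.1 this with h | h
    · have : x = √2 := by linarith
      exact Or.inl ⟨this, hyx.trans this, hzx.trans this⟩
    · have : x = -√2 := by linarith
      exact Or.inr ⟨this, hyx.trans this, hzx.trans this⟩
  · rintro (⟨rfl, rfl, rfl⟩ | ⟨rfl, rfl, rfl⟩)
    · exact ⟨le_rfl, le_rfl, by nlinarith, by nlinarith⟩
    · exact ⟨le_rfl, le_rfl, by nlinarith, by nlinarith⟩

theorem sqrt_two_mem_Ioo : √2 ∈ Set.Ioo (7 / 5 : ℝ) (3 / 2) :=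
  ⟨Real.lt_sqrt_of_sq_lt (by norm_num), (Real.sqrt_lt' (by norm_num)).2 (by norm_num)⟩

theorem nookConstraints_iff_of_pos {x y z : ℝ} (h₁ : 0 < x) (h₂ : x < 4) :
    NookConstraints x y z ↔ x = √2 ∧ y = √2 ∧ z = √2 := by
  rw [nookConstraints_iff (by linarith) h₂, or_iff_left]
  rintro ⟨h, -⟩
  linarith [Real.sqrt_nonneg 2]

theorem irrational_six_hundred_mul_sqrt_two : Irrational (600 * √2) := by
  simpa using irrational_sqrt_two.ratCast_mul (q := 600) (by norm_num)

/-- Necessity of the constraints holds on the full open edges, all of whose values of `x` lie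
between 0 and 4, so they already single out `√2`. Sufficiency is needed only on the short ranges
around `√2`. -/
theorem isBoundaryGuarding_iff {G : Set (ℝ × ℝ)} (hcard : G.encard ≤ 3) :
    (gallery (m := 25) vert).IsBoundaryGuarding G ↔
      G = {guardX 600 √2, guardY 600 √2, guardZ 600 √2} := by
  have hs := Set.Ioo_subset_Icc_self sqrt_two_mem_Ioo
  constructor
  · intro h
    obtain ⟨x, y, z, hx, hy, hz, rfl⟩ := exists_positions_of_isBoundaryGuarding hcard h
    obtain ⟨rfl, rfl, rfl⟩ := (nookConstraints_iff_of_pos (by linarith) (by linarith)).1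
      (nookConstraints_of_isBoundaryGuarding hx hy hz h)
    rfl
  · rintro rfl
    exact isBoundaryGuarding_of_constraints hs hs hs
      ((nookConstraints_iff_of_pos (by linarith [hs.1]) (by linarith [hs.2])).2 ⟨rfl, rfl, rfl⟩)

theorem encard_guards :
    ({guardX 600 √2, guardY 600 √2, guardZ 600 √2} : Set (ℝ × ℝ)).encard = 3 := by
  have h0 := Real.sqrt_nonneg 2
  refine Set.encard_eq_three.2 ⟨_, _, _, ?_, ?_, ?_, rfl⟩ <;> intro h <;>
    simp only [guardX_eq, guardY_eq, guardZ_eq, Prod.mk.injEq] at h <;> linarith [h.1, h.2]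

end ArtGallery

open ArtGallery

theorem mainTheorem7 :
    -- the four constraints, where both denominators are positive, have exactly two solutions
    (∀ x y z : ℝ, -4 < x → x < 4 →
      (NookConstraints x y z ↔
        (x = √2 ∧ y = √2 ∧ z = √2) ∨ (x = -√2 ∧ y = -√2 ∧ z = -√2))) ∧
    -- the art gallery `P`, the scale `N`, the ranges of the three variables and the four nooks
    ∃ (n : ℕ) (P : Polygon (ℝ × ℝ) n) (N : ℕ) (x₀ x₁ y₀ y₁ z₀ z₁ : ℚ) (s : Fin 4 → Fin n),
      P.IsSimplePlane ∧ P.HasIntegerVertices ∧ 0 < N ∧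
      (0 < x₀ ∧ x₁ < 4 ∧ 0 < y₀ ∧ 0 < z₀) ∧
      (√2 ∈ Set.Ioo (x₀ : ℝ) x₁ ∧ √2 ∈ Set.Ioo (y₀ : ℝ) y₁ ∧ √2 ∈ Set.Ioo (z₀ : ℝ) z₁) ∧
      -- the three segments of guard positions lie on the boundary
      (∀ x ∈ Set.Icc (x₀ : ℝ) x₁, guardX N x ∈ P.boundary ℝ) ∧
      (∀ y ∈ Set.Icc (y₀ : ℝ) y₁, guardY N y ∈ P.boundary ℝ) ∧
      (∀ z ∈ Set.Icc (z₀ : ℝ) z₁, guardZ N z ∈ P.boundary ℝ) ∧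
      -- four disjoint nooks, which impose the four constraints
      (∀ i, P.IsNook (s i)) ∧
      (∀ i j, i ≠ j → Disjoint (P.threeEdges (s i)) (P.threeEdges (s j))) ∧
      (∀ x ∈ Set.Icc (x₀ : ℝ) x₁, ∀ y ∈ Set.Icc (y₀ : ℝ) y₁, ∀ z ∈ Set.Icc (z₀ : ℝ) z₁,
        P.NookImposes (s 0) (guardX N x) (guardZ N z) (guardY N y) (z ≥ x) ∧
        P.NookImposes (s 1) (guardY N y) (guardZ N z) (guardX N x) (y ≥ z) ∧
        P.NookImposes (s 2) (guardX N x) (guardY N y) (guardZ N z)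
          ((4 * x + 2) / (x + 4) ≥ y) ∧
        P.NookImposes (s 3) (guardX N x) (guardY N y) (guardZ N z)
          ((4 * x - 2) / (-x + 4) ≥ y)) ∧
      -- at most three boundary guards see the boundary exactly if they are placed on the three
      -- segments, one on each, and represent values that satisfy the four constraints
      (∀ G : Set (ℝ × ℝ), G.encard ≤ 3 →
        (P.IsBoundaryGuarding G ↔
          ∃ x ∈ Set.Icc (x₀ : ℝ) x₁, ∃ y ∈ Set.Icc (y₀ : ℝ) y₁, ∃ z ∈ Set.Icc (z₀ : ℝ) z₁,
            G = {guardX N x, guardY N y, guardZ N z} ∧ NookConstraints x y z)) ∧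
      -- hence there is exactly one such set of guards, given by `x = y = z = √2`
      (∀ G : Set (ℝ × ℝ), G.encard ≤ 3 →
        (P.IsBoundaryGuarding G ↔ G = {guardX N √2, guardY N √2, guardZ N √2})) ∧
      -- three boundary guards suffice, but only with irrational coordinates
      (∃ G : Set (ℝ × ℝ), G.encard = 3 ∧ P.IsBoundaryGuarding G) ∧
      (∀ G : Set (ℝ × ℝ), G.encard ≤ 3 → P.IsBoundaryGuarding G →
        ∀ g ∈ G, Irrational g.1 ∨ Irrational g.2) := by
  have hs := sqrt_two_mem_Ioo
  have hs' := Set.Ioo_subset_Icc_self hs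
  refine ⟨fun x y z h₁ h₂ => nookConstraints_iff h₁ h₂, 26, gallery (m := 25) vert, 600,
    7 / 5, 3 / 2, 7 / 5, 3 / 2, 7 / 5, 3 / 2, nooks, isSimplePlane_vert,
    fun i => ⟨(vert i).1, (vert i).2, rfl⟩, by norm_num, by norm_num, ?_⟩
  push_cast
  refine ⟨⟨hs, hs, hs⟩, fun x hx => innerEdge_subset_boundary (guardX_mem_innerEdge hx),
    fun y hy => innerEdge_subset_boundary (guardY_mem_innerEdge hy),
    fun z hz => innerEdge_subset_boundary (guardZ_mem_innerEdge hz), ?_, ?_,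
    fun x hx y hy z hz => nookImposes_vert hx hy hz, ?_, fun G hG => isBoundaryGuarding_iff hG,
    ⟨_, encard_guards, (isBoundaryGuarding_iff encard_guards.le).2 rfl⟩, ?_⟩
  · intro i
    fin_cases i
    exacts [isNook_22, isNook_2, isNook_16, isNook_12]
  · intro i j hij
    exact disjoint_threeEdges (edgesApart_nooks i j hij)
  · intro G hG
    -- Since the constraints have `√2` as their only solution in the ranges, the description by
    -- positions is equivalent to the explicit one.
    rw [isBoundaryGuarding_iff hG]
    constructor
    · rintro rfl
      exact ⟨_, hs', _, hs', _, hs', rfl, (nookConstraints_iff_of_pos (by linarith [hs.1])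
        (by linarith [hs.2])).2 ⟨rfl, rfl, rfl⟩⟩
    · rintro ⟨x, hx, y, hy, z, hz, rfl, h⟩
      obtain ⟨rfl, rfl, rfl⟩ := (nookConstraints_iff_of_pos (by linarith [hx.1])
        (by linarith [hx.2])).1 h
      rfl
  · intro G hG h g hg
    rw [(isBoundaryGuarding_iff hG).1 h] at hg
    rcases hg with rfl | rfl | rfl
    · left
      rw [guardX_eq]
      simpa using irrational_six_hundred_mul_sqrt_two.neg
    · right
      rw [guardY_eq]
      simpa using irrational_six_hundred_mul_sqrt_two.ratCast_add 600
    · right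
      rw [guardZ_eq]
      simpa using irrational_six_hundred_mul_sqrt_two.ratCast_sub (-600)
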